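/- All manifolds and maps are smooth, and manifolds are finite-dimensional, Hausdorff, second countable and without boundary. A covector is a linear form on a tangent space, a $2$-vector field $\Lambda$ is a smooth field of alternating bilinear forms on covectors, $(V\wedge W)(\alpha,\beta)=\alpha(V)\beta(W)-\alpha(W)\beta(V)$, and the Schouten–Nijenhuis bracket of $2$-vector fields is normalized by $[\Lambda,\Lambda](df,dg,dh)=2\sum_{\mathrm{cyc}}\Lambda\big(d(\Lambda(df,dg)),dh\big)$. A Poisson structure is a $2$-vector field $\Pi$ with $[\Pi,\Pi]=0$; its bracket is $\{f,h\}=\Pi(df,dh)$ and its Hamiltonian vector fields are $X_h=-\Pi(dh,\cdot)$. A Jacobi structure on $M$ is a pair $(\Lambda,E)$ of a $2$-vector field and a vector field with $[\Lambda,\Lambda]=2\Lambda\wedge E$ and $\mathcal L_E\Lambda=0$; its Jacobi bracket is $\{f,h\}=\Lambda(df,dh)+fE(h)-hE(f)$, and its Poissonization is the $2$-vector field $e^{-t}\big(\Lambda-E\wedge\frac{\partial}{\partial t}\big)$ on $M\times\mathbb R$. **Theorem 3.1.** Let $A\to Q$ be a real vector bundle of finite rank, let $\Pi$ be a linear Poisson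 structure on the total space of the dual bundle $A^*$ (that is, a Poisson structure for which the bracket of two fiberwise linear functions is fiberwise linear), and let $g$ be a bundle metric on $A$. Let $\kappa(\alpha)=\frac12\|\alpha\|_g^2$ be the kinetic energy on $A^*$, where $\|\cdot\|_g$ is the norm on $A^*$ induced by $g$, let $X_\kappa$ be its Hamiltonian vector field, let $\Delta(\alpha)=\frac{d}{dt}\big|_{t=0}(1+t)\alpha$ be the Liouville vector field of $A^*$, let $S_g(A^*)=\kappa^{-1}(\frac12)$ be the unit sphere bundle, with inclusion $\iota:S_g(A^*)\to A^*$, and let $\mathcal O_Q$ be the zero section of $A^*$. Then: (i) The pair $(\Lambda,E)=(\Pi+\Delta\wedge X_\kappa,\,-X_\kappa)$ is a Jacobi structure on $A^*$. (ii) $S_g(A^*)$ is an embedded submanifold of $A^*$ of codimension one, and $(\Lambda,E)$ restricts to a Jacobi structure $(\Lambda_S,E_S)$ on it: $\Lambda_S(\iota^*\alpha,\iota^*\beta)=\Lambda(\alpha,\beta)$ and $d\iota(E_S)=E$ at every point of $S_g(A^*)$, for all covectors $\alpha,\beta$ of $A^*$ at that point. Moreover, the map $$\Psi:S_g(A^*)\times\mathbb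 R\to A^*\setminus\mathcal O_Q,\qquad \Psi(\beta,t)=e^t\beta,$$ is a diffeomorphism that carries the Poissonization of $(\Lambda_S,E_S)$ to the restriction of $\Pi$ to $A^*\setminus\mathcal O_Q$, i.e. it is a Poisson isomorphism. (iii) The Jacobi bracket $\{\cdot,\cdot\}_S$ of $(\Lambda_S,E_S)$ and the Poisson bracket $\{\cdot,\cdot\}$ of $\Pi$ satisfy, for all $G_1,G_2\in C^\infty(A^*)$, $$\{G_1\circ\iota,G_2\circ\iota\}_S=\Big(\{G_1,G_2\}-\{\kappa,G_1\}\,\big(G_2-\Delta(G_2)\big)+\{\kappa,G_2\}\,\big(G_1-\Delta(G_1)\big)\Big)\circ\iota .$$ -/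

import Mathlib

open scoped Manifold ContDiff Bundle
open Bundle Module

noncomputable section

/-! ## Bivector fields, Poisson structures and Jacobi structures on a manifold

All manifolds are real, smooth and finite-dimensional. Covectors at `x` are elements of the dual of
the tangent space, and a `2`-vector at `x` is an alternating bilinear form on covectors at `x`. -/

section Manifold

variable {E : Type*} [NormedAddCommGroup E] [NormedSpace ℝ E]
  {H : Type*} [TopologicalSpace H] (I : ModelWithCorners ℝ E H)
  {M : Type*} [TopologicalSpace M] [ChartedSpace H M]

instance tangentSpace_finiteDimensional [FiniteDimensional ℝ E] (x : M) :
    FiniteDimensional ℝ (TangentSpace I x) :=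
  inferInstanceAs (FiniteDimensional ℝ E)

/-- The cotangent space `T*_x M`. -/
abbrev Cotangent (x : M) : Type _ := Dual ℝ (TangentSpace I x)

/-- The differential `df(x) ∈ T*_x M` of a real function. -/
def differential (f : M → ℝ) (x : M) : Cotangent I x :=
  (mfderiv I 𝓘(ℝ, ℝ) f x : TangentSpace I x →L[ℝ] ℝ).toLinearMap

/-- The derivative `V(f) = df(V)` of a function along a vector field. -/
def lieDerivFun (V : ∀ x : M, TangentSpace I x) (f : M → ℝ) (x : M) : ℝ :=
  differential I f x (V x)

/-- Smoothness of a vector field, as a section of the tangent bundle. -/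
def IsSmoothVectorField [IsManifold I 1 M] (V : ∀ x : M, TangentSpace I x) : Prop :=
  ContMDiff I I.tangent ∞ (fun x ↦ (⟨x, V x⟩ : TangentBundle I M))

variable (M) in
/-- A field of bilinear forms on the cotangent spaces of `M`; it is a `2`-vector field when
`IsBivectorField` holds. -/
abbrev CoBilinField : Type _ := ∀ x : M, LinearMap.BilinForm ℝ (Cotangent I x)

/-- The function `Λ(df, dg)`. For a Poisson structure `Λ`, this is the Poisson bracket of
`f` and `g`. -/
def bivectorBracket (Λ : CoBilinField I M) (f g : M → ℝ) (x : M) : ℝ :=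
  Λ x (differential I f x) (differential I g x)

/-- `Λ` is a (smooth) `2`-vector field on `M`: it is alternating, and `Λ(df, dg)` is smooth for all
smooth functions `f` and `g` (on a Hausdorff manifold without boundary this is the smoothness of
the coefficients of `Λ` in charts, the coordinates being locally the restrictions of smooth
functions on `M`). -/
structure IsBivectorField (Λ : CoBilinField I M) : Prop where
  alt : ∀ x, (Λ x).IsAlt
  smooth : ∀ f g : M → ℝ, ContMDiff I 𝓘(ℝ, ℝ) ∞ f → ContMDiff I 𝓘(ℝ, ℝ) ∞ g →
    ContMDiff I 𝓘(ℝ, ℝ) ∞ (bivectorBracket I Λ f g)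

/-- The wedge product `V ∧ W` of two tangent vectors:
`(V ∧ W)(α, β) = α(V) β(W) - α(W) β(V)`. -/
def vecWedge {x : M} (V W : TangentSpace I x) : LinearMap.BilinForm ℝ (Cotangent I x) :=
  LinearMap.mk₂ ℝ (fun α β ↦ α V * β W - α W * β V)
    (by intros; simp only [LinearMap.add_apply]; ring)
    (by intros; simp only [LinearMap.smul_apply, smul_eq_mul]; ring)
    (by intros; simp only [LinearMap.add_apply]; ring)
    (by intros; simp only [LinearMap.smul_apply, smul_eq_mul]; ring)

/-- The wedge product of a `2`-vector and a vector at `x`, evaluated on three covectors. -/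
def bivectorWedge {x : M} (P : LinearMap.BilinForm ℝ (Cotangent I x)) (V : TangentSpace I x)
    (α β γ : Cotangent I x) : ℝ :=
  P α β * γ V + P β γ * α V + P γ α * β V

/-- The Schouten-Nijenhuis bracket `[P, Q]` of two `2`-vector fields, evaluated on `df, dg, dh`.
It is the graded commutator `P ∘ Q + Q ∘ P` of the biderivations `P` and `Q` of the algebra of
functions, where `(P ∘ Q)(f, g, h)` is the cyclic sum of `P(Q(f, g), h)`. -/
def schouten (P Q : CoBilinField I M) (f g h : M → ℝ) (x : M) : ℝ :=
  let c : CoBilinField I M → CoBilinField I M → (M → ℝ) → (M → ℝ) → (M → ℝ) → ℝ :=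
    fun P Q f g h ↦ bivectorBracket I P (bivectorBracket I Q f g) h x
  (c P Q f g h + c P Q g h f + c P Q h f g) + (c Q P f g h + c Q P g h f + c Q P h f g)

/-- The Lie derivative `L_V Λ` of a `2`-vector field, evaluated on `df, dg`. -/
def lieDerivBivector (V : ∀ x : M, TangentSpace I x) (Λ : CoBilinField I M)
    (f g : M → ℝ) (x : M) : ℝ :=
  lieDerivFun I V (bivectorBracket I Λ f g) x
    - bivectorBracket I Λ (lieDerivFun I V f) g x - bivectorBracket I Λ f (lieDerivFun I V g) x

/-- A Poisson structure: a `2`-vector field `P` with `[P, P] = 0`. -/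
structure IsPoissonStructure (P : CoBilinField I M) : Prop where
  isBivectorField : IsBivectorField I P
  schouten_self : ∀ f g h : M → ℝ, ContMDiff I 𝓘(ℝ, ℝ) ∞ f → ContMDiff I 𝓘(ℝ, ℝ) ∞ g →
    ContMDiff I 𝓘(ℝ, ℝ) ∞ h → ∀ x, schouten I P P f g h x = 0

/-- A Jacobi structure: a `2`-vector field `Λ` and a vector field `R` with
`[Λ, Λ] = 2 Λ ∧ R` and `L_R Λ = 0`. -/
structure IsJacobiStructure [IsManifold I 1 M] (Λ : CoBilinField I M)
    (R : ∀ x : M, TangentSpace I x) : Prop where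
  isBivectorField : IsBivectorField I Λ
  isSmoothVectorField : IsSmoothVectorField I R
  schouten_self : ∀ f g h : M → ℝ, ContMDiff I 𝓘(ℝ, ℝ) ∞ f → ContMDiff I 𝓘(ℝ, ℝ) ∞ g →
    ContMDiff I 𝓘(ℝ, ℝ) ∞ h → ∀ x, schouten I Λ Λ f g h x =
      2 * bivectorWedge I (Λ x) (R x) (differential I f x) (differential I g x) (differential I h x)
  lieDeriv : ∀ f g : M → ℝ, ContMDiff I 𝓘(ℝ, ℝ) ∞ f → ContMDiff I 𝓘(ℝ, ℝ) ∞ g →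
    ∀ x, lieDerivBivector I R Λ f g x = 0

/-- The Jacobi bracket `{f, g} = Λ(df, dg) + f R(g) - g R(f)`. -/
def jacobiBracket (Λ : CoBilinField I M) (R : ∀ x : M, TangentSpace I x) (f g : M → ℝ)
    (x : M) : ℝ :=
  bivectorBracket I Λ f g x + f x * lieDerivFun I R g x - g x * lieDerivFun I R f x

/-- The Hamiltonian vector field `X_h = -i(dh)P`, i.e. `β(X_h) = -P(dh, β)` for all covectors `β`
(the tangent space is identified with its bidual). -/
def hamiltonianVF [FiniteDimensional ℝ E] (P : CoBilinField I M) (h : M → ℝ) (x : M) :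
    TangentSpace I x :=
  -(evalEquiv ℝ (TangentSpace I x)).symm (P x (differential I h x))

/-- The restriction of a `2`-vector field to an open subset `U`, i.e. its transport along the
inverses of the differentials of the inclusion `U → M`. -/
def restrictOpens (P : CoBilinField I M) (U : TopologicalSpace.Opens M) : CoBilinField I U :=
  fun x ↦
    let e : TangentSpace I (x : M) →L[ℝ] TangentSpace I x :=
      (mfderiv I I (Subtype.val : U → M) x).inverse
    (P (x : M)).compl₁₂ e.toLinearMap.dualMap e.toLinearMap.dualMap

/-- The Poissonization `e^{-t} (Λ - R ∧ ∂/∂t)` on `M × ℝ` of a pair `(Λ, R)` on `M`; the tensors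
`Λ` and `R` are transported to `M × {t}` by the maps `y ↦ (y, t)`. -/
def poissonization (Λ : CoBilinField I M) (R : ∀ x : M, TangentSpace I x) :
    CoBilinField (I.prod 𝓘(ℝ, ℝ)) (M × ℝ) :=
  fun p ↦
    let j : TangentSpace I p.1 →L[ℝ] TangentSpace (I.prod 𝓘(ℝ, ℝ)) p :=
      mfderiv I (I.prod 𝓘(ℝ, ℝ)) (fun y : M ↦ (y, p.2)) p.1
    let k : ℝ →L[ℝ] TangentSpace (I.prod 𝓘(ℝ, ℝ)) p :=
      mfderiv 𝓘(ℝ, ℝ) (I.prod 𝓘(ℝ, ℝ)) (fun s : ℝ ↦ (p.1, s)) p.2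
    Real.exp (-p.2) •
      ((Λ p.1).compl₁₂ j.toLinearMap.dualMap j.toLinearMap.dualMap
        - vecWedge (I.prod 𝓘(ℝ, ℝ)) (j (R p.1)) (k 1))

variable {E' : Type*} [NormedAddCommGroup E'] [NormedSpace ℝ E']
  {H' : Type*} [TopologicalSpace H'] (J : ModelWithCorners ℝ E' H')
  {N : Type*} [TopologicalSpace N] [ChartedSpace H' N]

/-- The pullback `φ^* α = α ∘ dφ` of a covector along a map `φ : N → M`. -/
def covectorPullback (φ : N → M) (y : N) (α : Cotangent I (φ y)) : Cotangent J y :=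
  α ∘ₗ (mfderiv J I φ y).toLinearMap

/-- The fields `P` on `N` and `Q` on `M` are `φ`-related: `Q(α, β) = P(φ^* α, φ^* β)`. -/
def BivectorRelated (φ : N → M) (P : CoBilinField J N) (Q : CoBilinField I M) : Prop :=
  ∀ (y : N) (α β : Cotangent I (φ y)),
    P y (covectorPullback I J φ y α) (covectorPullback I J φ y β) = Q (φ y) α β

/-- The vector fields `V` on `N` and `W` on `M` are `φ`-related: `dφ(V) = W ∘ φ`. -/
def VectorRelated (φ : N → M) (V : ∀ y : N, TangentSpace J y) (W : ∀ x : M, TangentSpace I x) :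
    Prop :=
  ∀ y : N, mfderiv J I φ y (V y) = W (φ y)

/-- `φ : N → M` is a smooth embedding of finite-dimensional manifolds: a smooth map with injective
differentials that is a homeomorphism onto its image. -/
structure IsSmoothEmb (φ : N → M) : Prop where
  contMDiff : ContMDiff J I ∞ φ
  isEmbedding : Topology.IsEmbedding φ
  injective_mfderiv : ∀ y, Function.Injective (mfderiv J I φ y)

end Manifold

/-! ## The dual of a vector bundle -/

section DualBundle

variable {EQ : Type*} [NormedAddCommGroup EQ] [NormedSpace ℝ EQ]
  {HQ : Type*} [TopologicalSpace HQ] (I : ModelWithCorners ℝ EQ HQ)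
  {Q : Type*} [TopologicalSpace Q] [ChartedSpace HQ Q]
  (F : Type*) [NormedAddCommGroup F] [NormedSpace ℝ F]
  (A : Q → Type*) [TopologicalSpace (TotalSpace F A)]
  [∀ q, AddCommGroup (A q)] [∀ q, Module ℝ (A q)] [∀ q, TopologicalSpace (A q)]
  [∀ q, IsTopologicalAddGroup (A q)] [∀ q, ContinuousSMul ℝ (A q)]
  [FiberBundle F A] [VectorBundle ℝ F A]

/-- The total space of the dual bundle `A*` of a vector bundle `A` with typical fiber `F`. -/
abbrev DualTotal : Type _ := TotalSpace (F →L[ℝ] ℝ) (fun q ↦ A q →L[ℝ] ℝ)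

/-- The model with corners of the manifold `A*`. -/
abbrev dualModel : ModelWithCorners ℝ (EQ × (F →L[ℝ] ℝ)) (ModelProd HQ (F →L[ℝ] ℝ)) :=
  I.prod 𝓘(ℝ, F →L[ℝ] ℝ)

variable {F A} in
/-- The function `G` on `A*` is fiberwise linear. -/
def IsFiberwiseLinear (G : DualTotal F A → ℝ) : Prop :=
  ∀ q, IsLinearMap ℝ (fun α : A q →L[ℝ] ℝ ↦ G ⟨q, α⟩)

variable {F A} in
/-- A linear Poisson structure on `A*`: a Poisson structure for which the bracket of two fiberwise
linear functions is fiberwise linear. -/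
structure IsLinearPoissonStructure (P : CoBilinField (dualModel I F) (DualTotal F A)) : Prop where
  isPoissonStructure : IsPoissonStructure (dualModel I F) P
  linear : ∀ G₁ G₂ : DualTotal F A → ℝ,
    ContMDiff (dualModel I F) 𝓘(ℝ, ℝ) ∞ G₁ → ContMDiff (dualModel I F) 𝓘(ℝ, ℝ) ∞ G₂ →
    IsFiberwiseLinear G₁ → IsFiberwiseLinear G₂ →
    IsFiberwiseLinear (bivectorBracket (dualModel I F) P G₁ G₂)

/-- The Liouville vector field of `A*`: its value at `α` is the velocity at `t = 0` of the curve
`t ↦ (1 + t) α`. -/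
def liouville (p : DualTotal F A) : TangentSpace (dualModel I F) p :=
  (mfderiv 𝓘(ℝ, ℝ) (dualModel I F) (fun t : ℝ ↦ (⟨p.1, (1 + t) • p.2⟩ : DualTotal F A)) 0 :
    ℝ →L[ℝ] EQ × (F →L[ℝ] ℝ)) 1

/-- The complement of the zero section of `A*`, as an open subset. -/
def zeroSectionCompl : TopologicalSpace.Opens (DualTotal F A) where
  carrier := {p | p.2 ≠ 0}
  is_open' := by
    rw [isOpen_iff_mem_nhds]
    intro p hp
    let e := trivializationAt (F →L[ℝ] ℝ) (fun q ↦ A q →L[ℝ] ℝ) p.1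
    have hne : ∀ p' ∈ e.source, ((e p').2 = 0 ↔ p'.2 = 0) := by
      intro p' hp'
      have hb : p'.1 ∈ e.baseSet := e.mem_source.mp hp'
      have h : (e p').2 = e.continuousLinearEquivAt ℝ p'.1 hb p'.2 := rfl
      rw [h]
      exact map_eq_zero_iff _ (e.continuousLinearEquivAt ℝ p'.1 hb).injective
    have hps : p ∈ e.source := FiberBundle.mem_trivializationAt_proj_source
    have hc : ContinuousAt (fun p' ↦ (e p').2) p :=
      continuous_snd.continuousAt.comp (e.continuousAt hps)
    have hp0 : (e p).2 ≠ 0 := fun h ↦ hp ((hne p hps).mp h)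
    filter_upwards [hc.eventually_ne hp0, e.open_source.mem_nhds hps] with p' h1 h2
    exact fun h ↦ h1 ((hne p' h2).mpr h)

variable {I F A}

/-- The element `α♯` of the fiber `A_q` that corresponds to `α ∈ A*_q` under the isomorphism
`v ↦ g(v, ·)` defined by the bundle metric `g`. -/
def metricSharp (g : ContMDiffRiemannianMetric I ∞ F A) {q : Q} (α : A q →L[ℝ] ℝ) : A q :=
  (g.inner q).inverse α

/-- The kinetic energy `κ(α) = ‖α‖² / 2`, for the norm `‖α‖² = g(α♯, α♯)` on `A*` induced by `g`. -/
def kineticEnergy (g : ContMDiffRiemannianMetric I ∞ F A) (p : DualTotal F A) : ℝ :=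
  g.inner p.1 (metricSharp g p.2) (metricSharp g p.2) / 2

/-- The Hamiltonian vector field `X_κ` of the kinetic energy. -/
def kineticVF [FiniteDimensional ℝ EQ] [FiniteDimensional ℝ F]
    (P : CoBilinField (dualModel I F) (DualTotal F A)) (g : ContMDiffRiemannianMetric I ∞ F A)
    (p : DualTotal F A) : TangentSpace (dualModel I F) p :=
  hamiltonianVF (dualModel I F) P (kineticEnergy g) p

/-- The `2`-vector field `Λ = P + Δ ∧ X_κ` on `A*`. -/
def dualLambda [FiniteDimensional ℝ EQ] [FiniteDimensional ℝ F]
    (P : CoBilinField (dualModel I F) (DualTotal F A)) (g : ContMDiffRiemannianMetric I ∞ F A) :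
    CoBilinField (dualModel I F) (DualTotal F A) :=
  fun p ↦ P p + vecWedge (dualModel I F) (liouville I F A p) (kineticVF P g p)

/-- The vector field `R = -X_κ` on `A*`. -/
def dualReeb [FiniteDimensional ℝ EQ] [FiniteDimensional ℝ F]
    (P : CoBilinField (dualModel I F) (DualTotal F A)) (g : ContMDiffRiemannianMetric I ∞ F A)
    (p : DualTotal F A) : TangentSpace (dualModel I F) p :=
  -kineticVF P g p

/-- The unit sphere bundle `S_g(A*)`, the level set `κ = 1/2`. -/
def unitSphereBundle (g : ContMDiffRiemannianMetric I ∞ F A) : Set (DualTotal F A) :=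
  {p | kineticEnergy g p = 1 / 2}

/-- The inclusion `ι : S_g(A*) → A*`. -/
abbrev sphereIncl (g : ContMDiffRiemannianMetric I ∞ F A) : unitSphereBundle g → DualTotal F A :=
  Subtype.val

variable (I F) in
/-- The model with corners of `S_g(A*)`, of dimension `dim Q + rank A - 1`. -/
abbrev sphereModel : ModelWithCorners ℝ (EQ × EuclideanSpace ℝ (Fin (finrank ℝ F - 1)))
    (ModelProd HQ (EuclideanSpace ℝ (Fin (finrank ℝ F - 1)))) :=
  I.prod 𝓘(ℝ, EuclideanSpace ℝ (Fin (finrank ℝ F - 1)))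

end DualBundle

end

/-!
# The Jacobi structure on the unit sphere bundle of a linear Poisson structure

Everything rests on the homogeneity `L_Δ P = -P` of a linear Poisson structure `P` on `A*`, with
respect to the Liouville vector field `Δ`. Away from the zero section every covector is the
differential of a fiberwise linear function (`exists_isFiberwiseLinear_differential_eq`), and on such
functions `Δ` is the identity, as it is on their brackets. Since a vector field commutes with a
Hamiltonian vector field on functions at their critical points
(`lieDerivFun_comm_of_differential_eq_zero`), `L_Δ P` is determined by its values on such functions.
If the rank is positive, the identity extends to the zero section by continuity
(`IsLinearPoissonStructure.lieDeriv_liouville`); in rank zero `κ` and `Δ` vanish, and the pair in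
question is `(P, 0)`.

With `L_Δ P = -P` and `Δ(κ) = 2κ`, the axioms of a Jacobi structure for `(P + Δ ∧ X_κ, -X_κ)` are a
formal consequence of the Leibniz rules for `Δ` and `X_κ` and of the Jacobi identity for `P`
(`IsPoissonStructure.isJacobiStructure_add_wedge`).

On the sphere bundle `dκ(Δ) = 1`, so that `dκ` is in the kernel of `Λ = P + Δ ∧ X_κ`; as the covectors
that vanish on the sphere bundle are the multiples of `dκ`, `Λ` restricts to it
(`exists_bivectorRelated`), and `X_κ` is tangent to it. Smooth functions on the sphere bundle extend to
`A*`, and the axioms are inherited (`IsJacobiStructure.of_related`). The map `(β, t) ↦ e^t β` has an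
explicit inverse, and bijective differentials, so that it is a diffeomorphism by the inverse function
theorem. In the pullback of `P` under it, the terms of the Poissonization that contain `X_κ` cancel,
and the factor `e^{-t}` accounts for the homogeneity of `P` under `β ↦ e^t β`
(`IsLinearPoissonStructure.bivectorRelated_polarDiffeomorph`). The formula for the Jacobi bracket is
the definition of `(Λ, -X_κ)`, written out.

The sphere bundle has charts that combine the charts of `Q` with the central projections of open half
spheres to hyperplanes (`sphereChart`); their transition maps are smooth, since the charts are
restrictions of smooth maps of `A*` and their inverses are smooth as maps to `A*`
(`exists_isManifold_isSmoothEmb`).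
-/

open scoped Topology

noncomputable section

set_option linter.unusedSectionVars false

/-! ### Differentials of functions and smooth vector fields -/

section Calculus

variable {E : Type*} [NormedAddCommGroup E] [NormedSpace ℝ E]
  {H : Type*} [TopologicalSpace H] {I : ModelWithCorners ℝ E H}
  {M : Type*} [TopologicalSpace M] [ChartedSpace H M]
  {E' : Type*} [NormedAddCommGroup E'] [NormedSpace ℝ E']
  {H' : Type*} [TopologicalSpace H'] {J : ModelWithCorners ℝ E' H'}
  {N : Type*} [TopologicalSpace N] [ChartedSpace H' N]

theorem differential_congr {f g : M → ℝ} {x : M} (h : f =ᶠ[𝓝 x] g) :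
    differential I f x = differential I g x := by
  unfold differential
  rw [h.mfderiv_eq]

theorem differential_add {f g : M → ℝ} {x : M} (hf : MDifferentiableAt I 𝓘(ℝ, ℝ) f x)
    (hg : MDifferentiableAt I 𝓘(ℝ, ℝ) g x) :
    differential I (fun y ↦ f y + g y) x = differential I f x + differential I g x := by
  ext v
  have := (hf.hasMFDerivAt.add hg.hasMFDerivAt).mfderiv
  change mfderiv I 𝓘(ℝ, ℝ) (f + g) x v = _
  rw [this]; rfl

theorem differential_const (c : ℝ) (x : M) : differential I (fun _ : M ↦ c) x = 0 := by
  ext v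
  change mfderiv I 𝓘(ℝ, ℝ) (fun _ : M ↦ c) x v = _
  rw [mfderiv_const]; rfl

theorem differential_mul {f g : M → ℝ} {x : M} (hf : MDifferentiableAt I 𝓘(ℝ, ℝ) f x)
    (hg : MDifferentiableAt I 𝓘(ℝ, ℝ) g x) :
    differential I (fun y ↦ f y * g y) x = f x • differential I g x + g x • differential I f x := by
  ext v
  have := (hf.hasMFDerivAt.mul hg.hasMFDerivAt).mfderiv
  change mfderiv I 𝓘(ℝ, ℝ) (f * g) x v = _
  rw [this]; rfl

theorem differential_const_mul (c : ℝ) {f : M → ℝ} {x : M} (hf : MDifferentiableAt I 𝓘(ℝ, ℝ) f x) :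
    differential I (fun y ↦ c * f y) x = c • differential I f x := by
  rw [differential_mul mdifferentiableAt_const hf, differential_const]
  simp

theorem differential_neg {f : M → ℝ} {x : M} (hf : MDifferentiableAt I 𝓘(ℝ, ℝ) f x) :
    differential I (fun y ↦ -f y) x = -differential I f x := by
  have h := differential_const_mul (-1) hf
  rw [show (fun y ↦ -1 * f y) = fun y ↦ -f y by ext; ring] at h
  rw [h]
  ext v
  simp

theorem differential_sub {f g : M → ℝ} {x : M} (hf : MDifferentiableAt I 𝓘(ℝ, ℝ) f x)
    (hg : MDifferentiableAt I 𝓘(ℝ, ℝ) g x) :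
    differential I (fun y ↦ f y - g y) x = differential I f x - differential I g x := by
  have := differential_add hf (g := fun y ↦ -g y) hg.neg
  rw [differential_neg hg] at this
  simpa [sub_eq_add_neg] using this

/-- The chain rule `d(f ∘ φ) = φ^* df`. -/
theorem differential_comp {f : M → ℝ} {φ : N → M} {y : N}
    (hf : MDifferentiableAt I 𝓘(ℝ, ℝ) f (φ y)) (hφ : MDifferentiableAt J I φ y) :
    differential J (f ∘ φ) y = covectorPullback I J φ y (differential I f (φ y)) := by
  ext v
  change mfderiv J 𝓘(ℝ, ℝ) (f ∘ φ) y v = _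
  rw [mfderiv_comp y hf hφ]; rfl

theorem contMDiff_mdifferentiableAt {f : M → N} (hf : ContMDiff I J ∞ f) (x : M) :
    MDifferentiableAt I J f x :=
  (hf x).mdifferentiableAt (by simp)

theorem lieDerivFun_hamiltonianVF [FiniteDimensional ℝ E] (P : CoBilinField I M) (h f : M → ℝ)
    (x : M) : lieDerivFun I (hamiltonianVF I P h) f x = -bivectorBracket I P h f x := by
  unfold lieDerivFun hamiltonianVF bivectorBracket
  rw [map_neg]
  congr 1
  have := LinearMap.congr_fun
    ((evalEquiv ℝ (TangentSpace I x)).apply_symm_apply (P x (differential I h x)))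
    (differential I f x)
  simp

theorem hamiltonianVF_pairing [FiniteDimensional ℝ E] (P : CoBilinField I M) (h : M → ℝ)
    (x : M) (β : Cotangent I x) : β (hamiltonianVF I P h x) = -P x (differential I h x) β := by
  unfold hamiltonianVF
  rw [map_neg]
  congr 1
  have := LinearMap.congr_fun
    ((evalEquiv ℝ (TangentSpace I x)).apply_symm_apply (P x (differential I h x))) β
  simp

section Coordinates

variable [FiniteDimensional ℝ E] [T2Space M] [IsManifold I ∞ M]

variable (I) in
/-- Local coordinates extend to a global smooth function with values in the model space. -/
theorem exists_contMDiff_eventuallyEq_extChartAt (x₀ : M) :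
    ∃ u : M → E, ContMDiff I 𝓘(ℝ, E) ∞ u ∧ u =ᶠ[𝓝 x₀] extChartAt I x₀ := by
  obtain ⟨f⟩ := (inferInstance : Nonempty (SmoothBumpFunction I x₀))
  refine ⟨fun x ↦ f x • extChartAt I x₀ x, f.contMDiff_smul contMDiffOn_extChartAt, ?_⟩
  filter_upwards [f.eventuallyEq_one] with x hx
  simp [hx]

variable [I.Boundaryless]

/-- A smooth function is, near a point, a smooth function of coordinates. -/
theorem exists_eventuallyEq_comp_coordinates {r : M → ℝ} (hr : ContMDiff I 𝓘(ℝ, ℝ) ∞ r) {x₀ : M}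
    {u : M → E} (hu : u =ᶠ[𝓝 x₀] extChartAt I x₀) :
    ∃ R : E → ℝ, ContDiffAt ℝ ∞ R (u x₀) ∧ r =ᶠ[𝓝 x₀] R ∘ u := by
  refine ⟨r ∘ (extChartAt I x₀).symm, ?_, ?_⟩
  · have h := (contMDiffAt_iff.1 (hr x₀)).2
    rw [I.range_eq_univ, contDiffWithinAt_univ] at h
    rw [hu.eq_of_nhds]
    exact h
  · filter_upwards [hu, extChartAt_source_mem_nhds (I := I) x₀] with x hx hs
    rw [Function.comp_apply, Function.comp_apply, hx, (extChartAt I x₀).left_inv hs]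

/-- If a vector field maps smooth functions to smooth functions, then the components of its image
under a smooth vector-valued function are smooth. -/
theorem contMDiff_mfderiv_apply {V : ∀ x : M, TangentSpace I x}
    (hV : ∀ f : M → ℝ, ContMDiff I 𝓘(ℝ, ℝ) ∞ f → ContMDiff I 𝓘(ℝ, ℝ) ∞ (lieDerivFun I V f))
    {u : M → E} (hu : ContMDiff I 𝓘(ℝ, E) ∞ u) :
    ContMDiff I 𝓘(ℝ, E) ∞ (fun x ↦ (mfderiv I 𝓘(ℝ, E) u x (V x) : E)) := by
  let b := (Module.finBasis ℝ E).equivFunL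
  suffices h : ContMDiff I 𝓘(ℝ, Fin (finrank ℝ E) → ℝ) ∞
      (fun x ↦ b (mfderiv I 𝓘(ℝ, E) u x (V x) : E)) by
    have := b.symm.contDiff.contMDiff.comp h
    refine this.congr fun x ↦ ?_
    exact (b.symm_apply_apply _).symm
  rw [contMDiff_pi_space]
  intro i
  let ℓ : E →L[ℝ] ℝ := (ContinuousLinearMap.proj i).comp (b : E →L[ℝ] (Fin (finrank ℝ E) → ℝ))
  have h := hV (ℓ ∘ u) (ℓ.contDiff.contMDiff.comp hu)
  refine h.congr fun x ↦ ?_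
  have := mfderiv_comp x (ℓ.hasMFDerivAt.mdifferentiableAt (x := u x))
    (contMDiff_mdifferentiableAt hu x)
  change _ = mfderiv I 𝓘(ℝ, ℝ) (ℓ ∘ u) x (V x)
  rw [this, ℓ.hasMFDerivAt.mfderiv]
  rfl

theorem lieDerivFun_eq_fderiv {r : M → ℝ} {u : M → E} {R : E → ℝ} {x : M}
    (hu : MDifferentiableAt I 𝓘(ℝ, E) u x) (hR : DifferentiableAt ℝ R (u x))
    (h : r =ᶠ[𝓝 x] R ∘ u) (V : ∀ x : M, TangentSpace I x) :
    lieDerivFun I V r x = fderiv ℝ R (u x) (mfderiv I 𝓘(ℝ, E) u x (V x) : E) := by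
  unfold lieDerivFun
  rw [differential_congr h, differential_comp hR.mdifferentiableAt hu]
  change mfderiv 𝓘(ℝ, E) 𝓘(ℝ, ℝ) R (u x) _ = _
  rw [mfderiv_eq_fderiv]; rfl

/-- At a critical point `x₀` of `r`, the iterated derivative `V(W(r))` is the Hessian of `r` in
coordinates, evaluated on the values of `V` and `W` at `x₀`. -/
theorem lieDerivFun_lieDerivFun_eq {V W : ∀ x : M, TangentSpace I x}
    (hW : ∀ f : M → ℝ, ContMDiff I 𝓘(ℝ, ℝ) ∞ f → ContMDiff I 𝓘(ℝ, ℝ) ∞ (lieDerivFun I W f))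
    {r : M → ℝ} {x₀ : M} (h0 : differential I r x₀ = 0)
    {u : M → E} (hu : ContMDiff I 𝓘(ℝ, E) ∞ u) (hux : u =ᶠ[𝓝 x₀] extChartAt I x₀)
    {R : E → ℝ} (hR : ContDiffAt ℝ ∞ R (u x₀)) (hrR : r =ᶠ[𝓝 x₀] R ∘ u) :
    lieDerivFun I V (lieDerivFun I W r) x₀ = fderiv ℝ (fderiv ℝ R) (u x₀) (V x₀) (W x₀) := by
  have hid : ∀ v : TangentSpace I x₀, (mfderiv I 𝓘(ℝ, E) u x₀ v : E) = v := fun v ↦ by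
    rw [hux.mfderiv_eq, mfderiv_extChartAt_self]; rfl
  have hR0 : fderiv ℝ R (u x₀) = 0 := by
    ext v
    have h1 := lieDerivFun_eq_fderiv (contMDiff_mdifferentiableAt hu x₀)
      (hR.differentiableAt (by simp)) hrR (fun _ ↦ v)
    have h2 : lieDerivFun I (fun _ ↦ v) r x₀ = 0 := by
      unfold lieDerivFun
      rw [h0]
      rfl
    rw [h2] at h1
    refine Eq.trans ?_ h1.symm
    exact congrArg (fderiv ℝ R (u x₀)) (hid v).symm
  set w : M → E := fun x ↦ (mfderiv I 𝓘(ℝ, E) u x (W x) : E) with hw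
  have hws : ContMDiff I 𝓘(ℝ, E) ∞ w := contMDiff_mfderiv_apply hW hu
  have hev : lieDerivFun I W r =ᶠ[𝓝 x₀] fun x ↦ fderiv ℝ R (u x) (w x) := by
    have h1 : ∀ᶠ x in 𝓝 x₀, DifferentiableAt ℝ R (u x) := by
      have h2 : ∀ᶠ z in 𝓝 (u x₀), ContDiffAt ℝ 1 R z :=
        (hR.of_le (by simp) : ContDiffAt ℝ 1 R (u x₀)).eventually (by simp)
      exact (hu.continuous.continuousAt.eventually h2).mono
        fun x hx ↦ hx.differentiableAt (by simp)
    filter_upwards [h1, hrR.eventuallyEq_nhds] with x hx hx'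
    exact lieDerivFun_eq_fderiv (contMDiff_mdifferentiableAt hu x) hx hx' W
  have hd : HasFDerivAt (fderiv ℝ R) (fderiv ℝ (fderiv ℝ R) (u x₀)) (u x₀) :=
    ((hR.fderiv_right (m := 1) (by norm_cast)).differentiableAt (by simp)).hasFDerivAt
  have hA : HasFDerivAt (fun z : E × E ↦ fderiv ℝ R z.1 z.2) _ (u x₀, w x₀) :=
    (hd.comp (u x₀, w x₀) hasFDerivAt_fst).clm_apply hasFDerivAt_snd
  have hux' := (contMDiff_mdifferentiableAt hu x₀).hasMFDerivAt
  have hwx := (contMDiff_mdifferentiableAt hws x₀).hasMFDerivAt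
  have hm := HasMFDerivAt.comp x₀ (f := fun x ↦ (u x, w x)) hA.hasMFDerivAt
    (I' := 𝓘(ℝ, E × E))
    ⟨hux'.1.prodMk hwx.1, hux'.2.prodMk hwx.2⟩
  unfold lieDerivFun at hev ⊢
  rw [differential_congr hev]
  change mfderiv I 𝓘(ℝ, ℝ) _ x₀ (V x₀) = _
  have hm' := hm.mfderiv
  simp only [Function.comp_def] at hm'
  rw [hm']
  have e1 := hid (V x₀)
  have e2 : w x₀ = W x₀ := hid (W x₀)
  -- the derivative of the components of `W` is paired with `dR = 0`
  have e3 : ∀ a b : E, fderiv ℝ R (u x₀) a + fderiv ℝ (fderiv ℝ R) (u x₀) b (w x₀) =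
      fderiv ℝ (fderiv ℝ R) (u x₀) b (w x₀) := fun a b ↦ by simp [hR0]
  exact (e3 _ _).trans (congrArg₂ (fun a b : E ↦ fderiv ℝ (fderiv ℝ R) (u x₀) a b) e1 e2)

/-- Two vector fields commute on functions at a critical point, by the symmetry of the Hessian. -/
theorem lieDerivFun_comm_of_differential_eq_zero {V W : ∀ x : M, TangentSpace I x}
    (hV : ∀ f : M → ℝ, ContMDiff I 𝓘(ℝ, ℝ) ∞ f → ContMDiff I 𝓘(ℝ, ℝ) ∞ (lieDerivFun I V f))
    (hW : ∀ f : M → ℝ, ContMDiff I 𝓘(ℝ, ℝ) ∞ f → ContMDiff I 𝓘(ℝ, ℝ) ∞ (lieDerivFun I W f))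
    {r : M → ℝ} (hr : ContMDiff I 𝓘(ℝ, ℝ) ∞ r) {x₀ : M} (h0 : differential I r x₀ = 0) :
    lieDerivFun I V (lieDerivFun I W r) x₀ = lieDerivFun I W (lieDerivFun I V r) x₀ := by
  obtain ⟨u, hu, hux⟩ := exists_contMDiff_eventuallyEq_extChartAt I x₀
  obtain ⟨R, hR, hrR⟩ := exists_eventuallyEq_comp_coordinates hr hux
  rw [lieDerivFun_lieDerivFun_eq hW h0 hu hux hR hrR, lieDerivFun_lieDerivFun_eq hV h0 hu hux hR hrR]
  exact hR.isSymmSndFDerivAt (by simp; norm_cast) _ _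

/-- A vector field which maps smooth functions to smooth functions is smooth. -/
theorem isSmoothVectorField_of_lieDerivFun {V : ∀ x : M, TangentSpace I x}
    (hV : ∀ f : M → ℝ, ContMDiff I 𝓘(ℝ, ℝ) ∞ f → ContMDiff I 𝓘(ℝ, ℝ) ∞ (lieDerivFun I V f)) :
    IsSmoothVectorField I V := by
  intro x₀
  obtain ⟨u, hu, hux⟩ := exists_contMDiff_eventuallyEq_extChartAt I x₀
  have h := contMDiff_mfderiv_apply hV hu x₀
  rw [Bundle.contMDiffAt_section]
  refine h.congr_of_eventuallyEq ?_
  filter_upwards [hux.eventuallyEq_nhds, (chartAt H x₀).open_source.mem_nhds (mem_chart_source H x₀)]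
    with x hx hs
  rw [hx.mfderiv_eq, ← TangentBundle.continuousLinearMapAt_trivializationAt hs]
  have hb : x ∈ (trivializationAt E (TangentSpace I) x₀).baseSet := by simpa using hs
  exact (congrFun (Trivialization.coe_linearMapAt_of_mem (R := ℝ) _ hb) (V x)).symm

/-- Every covector is the differential of a function of coordinates with a prescribed
derivative. -/
theorem differential_comp_coordinates {x₀ : M} {u : M → E}
    (hux : u =ᶠ[𝓝 x₀] extChartAt I x₀) {R : E → ℝ} {L : E →L[ℝ] ℝ}
    (hR : HasFDerivAt R L (extChartAt I x₀ x₀)) (v : TangentSpace I x₀) :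
    differential I (R ∘ u) x₀ v = L v := by
  have hm : MDifferentiableAt I 𝓘(ℝ, E) u x₀ :=
    (mdifferentiableAt_extChartAt (mem_chart_source H x₀)).congr_of_eventuallyEq hux
  rw [← hux.eq_of_nhds] at hR
  rw [differential_comp hR.differentiableAt.mdifferentiableAt hm]
  change mfderiv 𝓘(ℝ, E) 𝓘(ℝ, ℝ) R (u x₀) (mfderiv I 𝓘(ℝ, E) u x₀ v) = _
  rw [mfderiv_eq_fderiv, hR.fderiv, hux.mfderiv_eq, mfderiv_extChartAt_self]
  rfl

end Coordinates
end Calculus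

/-! ### Jacobi structures from a Poisson structure and a homogeneity field -/

section JacobiAlgebra

variable {E : Type*} [NormedAddCommGroup E] [NormedSpace ℝ E]
  {H : Type*} [TopologicalSpace H] {I : ModelWithCorners ℝ E H}
  {M : Type*} [TopologicalSpace M] [ChartedSpace H M]

theorem vecWedge_apply {x : M} (V W : TangentSpace I x) (α β : Cotangent I x) :
    vecWedge I V W α β = α V * β W - α W * β V := rfl

theorem vecWedge_isAlt {x : M} (V W : TangentSpace I x) : (vecWedge I V W).IsAlt := fun α ↦ by
  rw [vecWedge_apply]; ring

theorem bivectorBracket_swap {P : CoBilinField I M} (hP : ∀ x, (P x).IsAlt) (f g : M → ℝ) (x : M) :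
    bivectorBracket I P f g x = -bivectorBracket I P g f x :=
  (LinearMap.IsAlt.neg (hP x) _ _).symm

theorem bivectorBracket_neg_left (P : CoBilinField I M) {f : M → ℝ} (g : M → ℝ) {x : M}
    (hf : MDifferentiableAt I 𝓘(ℝ, ℝ) f x) :
    bivectorBracket I P (fun y ↦ -f y) g x = -bivectorBracket I P f g x := by
  simp [bivectorBracket, differential_neg hf]

theorem schouten_self_eq (P : CoBilinField I M) (f g h : M → ℝ) (x : M) :
    schouten I P P f g h x = 2 * (bivectorBracket I P (bivectorBracket I P f g) h x +
      bivectorBracket I P (bivectorBracket I P g h) f x +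
      bivectorBracket I P (bivectorBracket I P h f) g x) := by
  simp only [schouten]; ring

/-- Hamiltonian vector fields of a Poisson structure are derivations of its bracket. -/
theorem lieDerivFun_hamiltonianVF_bracket [FiniteDimensional ℝ E] {P : CoBilinField I M}
    (hP : IsPoissonStructure I P) {k f g : M → ℝ} (hk : ContMDiff I 𝓘(ℝ, ℝ) ∞ k)
    (hf : ContMDiff I 𝓘(ℝ, ℝ) ∞ f) (hg : ContMDiff I 𝓘(ℝ, ℝ) ∞ g) (x : M) :
    lieDerivFun I (hamiltonianVF I P k) (bivectorBracket I P f g) x =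
      bivectorBracket I P (lieDerivFun I (hamiltonianVF I P k) f) g x +
      bivectorBracket I P f (lieDerivFun I (hamiltonianVF I P k) g) x := by
  have halt := hP.isBivectorField.alt
  have hX : ∀ f, lieDerivFun I (hamiltonianVF I P k) f = fun x ↦ -bivectorBracket I P k f x :=
    fun f ↦ funext fun x ↦ lieDerivFun_hamiltonianVF P k f x
  have hs := hP.schouten_self f g k hf hg hk x
  rw [schouten_self_eq] at hs
  have hkf := contMDiff_mdifferentiableAt (hP.isBivectorField.smooth k f hk hf) x
  have hkg := contMDiff_mdifferentiableAt (hP.isBivectorField.smooth k g hk hg) x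
  have e : bivectorBracket I P g k = fun y ↦ -bivectorBracket I P k g y :=
    funext fun y ↦ bivectorBracket_swap halt g k y
  rw [e, bivectorBracket_neg_left P f hkg] at hs
  rw [hX, hX f, hX g, bivectorBracket_neg_left P g hkf,
    bivectorBracket_swap halt f (fun y ↦ -bivectorBracket I P k g y) x,
    bivectorBracket_neg_left P f hkg]
  have := bivectorBracket_swap halt k (bivectorBracket I P f g) x
  simp only [this]
  linarith

/-- If `P` is a Poisson structure, `D` a vector field with `L_D P = -P` and `k` a function with
`D k = 2 k`, then `(P + D ∧ X_k, -X_k)` is a Jacobi structure. -/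
theorem IsPoissonStructure.isJacobiStructure_add_wedge [FiniteDimensional ℝ E] [T2Space M]
    [IsManifold I ∞ M] [I.Boundaryless] {P : CoBilinField I M} (hP : IsPoissonStructure I P)
    {D : ∀ x : M, TangentSpace I x} {k : M → ℝ} (hk : ContMDiff I 𝓘(ℝ, ℝ) ∞ k)
    (hD : ∀ f : M → ℝ, ContMDiff I 𝓘(ℝ, ℝ) ∞ f → ContMDiff I 𝓘(ℝ, ℝ) ∞ (lieDerivFun I D f))
    (hDk : ∀ x, lieDerivFun I D k x = 2 * k x)
    (hDP : ∀ f g : M → ℝ, ContMDiff I 𝓘(ℝ, ℝ) ∞ f → ContMDiff I 𝓘(ℝ, ℝ) ∞ g → ∀ x,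
      lieDerivFun I D (bivectorBracket I P f g) x = bivectorBracket I P (lieDerivFun I D f) g x +
        bivectorBracket I P f (lieDerivFun I D g) x - bivectorBracket I P f g x) :
    IsJacobiStructure I (fun x ↦ P x + vecWedge I (D x) (hamiltonianVF I P k x))
      (fun x ↦ -hamiltonianVF I P k x) := by
  have halt := hP.isBivectorField.alt
  set b := bivectorBracket I P with hb
  set X := lieDerivFun I (hamiltonianVF I P k) with hX
  set Δ := lieDerivFun I D with hΔ
  have hbs : ∀ {f g}, ContMDiff I 𝓘(ℝ, ℝ) ∞ f → ContMDiff I 𝓘(ℝ, ℝ) ∞ g →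
      ContMDiff I 𝓘(ℝ, ℝ) ∞ (b f g) := fun hf hg ↦ hP.isBivectorField.smooth _ _ hf hg
  have hXeq : ∀ f, X f = fun x ↦ -b k f x := fun f ↦ funext fun x ↦
    lieDerivFun_hamiltonianVF P k f x
  have hXs : ∀ {f}, ContMDiff I 𝓘(ℝ, ℝ) ∞ f → ContMDiff I 𝓘(ℝ, ℝ) ∞ (X f) := fun {f} hf ↦ by
    rw [hXeq]; exact (hbs hk hf).neg
  have hDs : ∀ {f}, ContMDiff I 𝓘(ℝ, ℝ) ∞ f → ContMDiff I 𝓘(ℝ, ℝ) ∞ (Δ f) := fun {f} hf ↦ hD f hf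
  have hXb : ∀ {f g}, ContMDiff I 𝓘(ℝ, ℝ) ∞ f → ContMDiff I 𝓘(ℝ, ℝ) ∞ g → ∀ x,
      X (b f g) x = b (X f) g x + b f (X g) x :=
    fun hf hg x ↦ lieDerivFun_hamiltonianVF_bracket hP hk hf hg x
  -- the commutator of `D` and `X_k` is `X_k`
  have hDX : ∀ {f}, ContMDiff I 𝓘(ℝ, ℝ) ∞ f → ∀ x, Δ (X f) x = X (Δ f) x + X f x := by
    intro f hf x
    have h1 := hDP k f hk hf x
    have e1 : Δ (X f) x = -Δ (b k f) x := by
      rw [hXeq, hΔ]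
      unfold lieDerivFun
      rw [differential_neg (contMDiff_mdifferentiableAt (hbs hk hf) x)]
      rfl
    have e2 : b (Δ k) f x = 2 * b k f x := by
      have : Δ k = fun y ↦ 2 * k y := funext hDk
      rw [this, hb]
      unfold bivectorBracket
      rw [differential_const_mul 2 (contMDiff_mdifferentiableAt hk x)]
      simp
    rw [e1, h1, e2, hXeq, hXeq]
    ring
  have hLb : ∀ f g, bivectorBracket I (fun x ↦ P x + vecWedge I (D x) (hamiltonianVF I P k x)) f g =
      fun x ↦ b f g x + (Δ f x * X g x - X f x * Δ g x) := fun f g ↦ rfl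
  have hLs : ∀ f g, ContMDiff I 𝓘(ℝ, ℝ) ∞ f → ContMDiff I 𝓘(ℝ, ℝ) ∞ g → ContMDiff I 𝓘(ℝ, ℝ) ∞
      (fun x ↦ b f g x + (Δ f x * X g x - X f x * Δ g x)) := fun f g hf hg ↦
    (hbs hf hg).add (((hDs hf).mul (hXs hg)).sub ((hXs hf).mul (hDs hg)))
  have hLd : ∀ {f g}, ContMDiff I 𝓘(ℝ, ℝ) ∞ f → ContMDiff I 𝓘(ℝ, ℝ) ∞ g → ∀ x,
      differential I (fun x ↦ b f g x + (Δ f x * X g x - X f x * Δ g x)) x =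
        differential I (b f g) x + (Δ f x • differential I (X g) x + X g x • differential I (Δ f) x -
          (X f x • differential I (Δ g) x + Δ g x • differential I (X f) x)) := by
    intro f g hf hg x
    have m1 := contMDiff_mdifferentiableAt (hbs hf hg) x
    have m2 := contMDiff_mdifferentiableAt (hDs hf) x
    have m3 := contMDiff_mdifferentiableAt (hXs hg) x
    have m4 := contMDiff_mdifferentiableAt (hXs hf) x
    have m5 := contMDiff_mdifferentiableAt (hDs hg) x
    have m23 : MDifferentiableAt I 𝓘(ℝ, ℝ) (fun y ↦ Δ f y * X g y) x := m2.mul m3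
    have m45 : MDifferentiableAt I 𝓘(ℝ, ℝ) (fun y ↦ X f y * Δ g y) x := m4.mul m5
    have m : MDifferentiableAt I 𝓘(ℝ, ℝ) (fun y ↦ Δ f y * X g y - X f y * Δ g y) x := m23.sub m45
    rw [differential_add m1 m, differential_sub m23 m45,
      differential_mul m2 m3, differential_mul m4 m5]
  have hswap : ∀ f g x, b f g x = -b g f x := bivectorBracket_swap halt
  -- the bracket of `P + D ∧ X_k`, iterated
  have hLL : ∀ {f g h}, ContMDiff I 𝓘(ℝ, ℝ) ∞ f → ContMDiff I 𝓘(ℝ, ℝ) ∞ g → ∀ x,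
      bivectorBracket I (fun x ↦ P x + vecWedge I (D x) (hamiltonianVF I P k x))
        (fun x ↦ b f g x + (Δ f x * X g x - X f x * Δ g x)) h x =
      (b (b f g) h x + (Δ f x * b (X g) h x + X g x * b (Δ f) h x -
        (X f x * b (Δ g) h x + Δ g x * b (X f) h x))) +
      ((Δ (b f g) x + (Δ f x * Δ (X g) x + X g x * Δ (Δ f) x -
        (X f x * Δ (Δ g) x + Δ g x * Δ (X f) x))) * X h x -
       (X (b f g) x + (Δ f x * X (X g) x + X g x * X (Δ f) x -
        (X f x * X (Δ g) x + Δ g x * X (X f) x))) * Δ h x) := by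
    intro f g h hf hg x
    have : bivectorBracket I (fun x ↦ P x + vecWedge I (D x) (hamiltonianVF I P k x))
        (fun x ↦ b f g x + (Δ f x * X g x - X f x * Δ g x)) h x =
        (P x + vecWedge I (D x) (hamiltonianVF I P k x)) (differential I
          (fun x ↦ b f g x + (Δ f x * X g x - X f x * Δ g x)) x) (differential I h x) := rfl
    have key : ∀ (α β γ δ ε θ : Cotangent I x) (p q r s : ℝ) (V W : TangentSpace I x),
        (P x + vecWedge I V W) (α + (p • β + q • γ - (r • δ + s • ε))) θ =
        (P x α θ + (p * P x β θ + q * P x γ θ - (r * P x δ θ + s * P x ε θ))) +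
        ((α V + (p * β V + q * γ V - (r * δ V + s * ε V))) * θ W -
         (α W + (p * β W + q * γ W - (r * δ W + s * ε W))) * θ V) := by
      intro α β γ δ ε θ p q r s V W
      simp only [LinearMap.add_apply, LinearMap.sub_apply, LinearMap.smul_apply, map_add, map_sub,
        map_smul, vecWedge_apply, smul_eq_mul]
      ring
    rw [this, hLd hf hg]
    exact key _ _ _ _ _ _ _ _ _ _ _ _
  refine ⟨⟨fun x α ↦ ?_, fun f g hf hg ↦ ?_⟩, ?_, ?_, ?_⟩
  · rw [LinearMap.add_apply, LinearMap.add_apply, halt x α, vecWedge_isAlt _ _ α, add_zero]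
  · rw [hLb]; exact hLs f g hf hg
  · refine isSmoothVectorField_of_lieDerivFun fun f hf ↦ (hXs hf).neg.congr fun x ↦ ?_
    exact map_neg _ _
  · intro f g h hf hg hh x
    have hJ := hP.schouten_self f g h hf hg hh x
    rw [schouten_self_eq] at hJ ⊢
    rw [hLb f g, hLb g h, hLb h f, hLL hf hg, hLL hg hh, hLL hh hf]
    have hR : ∀ α β γ : Cotangent I x, bivectorWedge I
        (P x + vecWedge I (D x) (hamiltonianVF I P k x)) (-hamiltonianVF I P k x) α β γ =
        -((P x α β + (α (D x) * β (hamiltonianVF I P k x) - α (hamiltonianVF I P k x) * β (D x))) *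
            γ (hamiltonianVF I P k x) +
          (P x β γ + (β (D x) * γ (hamiltonianVF I P k x) - β (hamiltonianVF I P k x) * γ (D x))) *
            α (hamiltonianVF I P k x) +
          (P x γ α + (γ (D x) * α (hamiltonianVF I P k x) - γ (hamiltonianVF I P k x) * α (D x))) *
            β (hamiltonianVF I P k x)) := by
      intro α β γ
      simp only [bivectorWedge, LinearMap.add_apply, vecWedge_apply, map_neg]
      ring
    rw [hR]
    change _ = 2 * -((b f g x + (Δ f x * X g x - X f x * Δ g x)) * X h x +
      (b g h x + (Δ g x * X h x - X g x * Δ h x)) * X f x +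
      (b h f x + (Δ h x * X f x - X h x * Δ f x)) * X g x)
    -- expand by the Leibniz rules for `D` and `X_k`: what remains is the Jacobi identity for `P`
    have hDP' : ∀ {f g}, ContMDiff I 𝓘(ℝ, ℝ) ∞ f → ContMDiff I 𝓘(ℝ, ℝ) ∞ g →
      Δ (b f g) x = b (Δ f) g x + b f (Δ g) x - b f g x := fun hf hg ↦ hDP _ _ hf hg x
    rw [hDP' hf hg, hDP' hg hh, hDP' hh hf, hXb hf hg, hXb hg hh, hXb hh hf, hDX hf, hDX hg, hDX hh,
      hswap f (X g), hswap g (X h), hswap h (X f), hswap f (Δ g), hswap g (Δ h), hswap h (Δ f)]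
    linear_combination hJ
  · intro f g hf hg x
    have hE : ∀ f, lieDerivFun I (fun x ↦ -hamiltonianVF I P k x) f = fun x ↦ -X f x :=
      fun f ↦ funext fun x ↦ map_neg _ _
    have hXf := contMDiff_mdifferentiableAt (hXs hf) x
    have hXg := contMDiff_mdifferentiableAt (hXs hg) x
    unfold lieDerivBivector
    rw [hE, hE, hE, hLb f g, bivectorBracket_neg_left _ _ hXf]
    have e1 : X (fun x ↦ b f g x + (Δ f x * X g x - X f x * Δ g x)) x =
        X (b f g) x + (Δ f x * X (X g) x + X g x * X (Δ f) x -
        (X f x * X (Δ g) x + Δ g x * X (X f) x)) := by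
      exact LinearMap.congr_fun (hLd hf hg x) (hamiltonianVF I P k x)
    have e2 : bivectorBracket I (fun x ↦ P x + vecWedge I (D x) (hamiltonianVF I P k x)) f
        (fun x ↦ -X g x) x = -(b f (X g) x + (Δ f x * X (X g) x - X f x * Δ (X g) x)) := by
      unfold bivectorBracket
      rw [differential_neg hXg, map_neg]
      rfl
    simp only [e1, e2, hLb, hXb hf hg, hDX hf, hDX hg]
    ring

end JacobiAlgebra

/-! ### The dual bundle, fiberwise scaling and the kinetic energy -/

section DualBundleGeometry

variable {EQ : Type*} [NormedAddCommGroup EQ] [NormedSpace ℝ EQ]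
  {HQ : Type*} [TopologicalSpace HQ] {I : ModelWithCorners ℝ EQ HQ}
  {Q : Type*} [TopologicalSpace Q] [ChartedSpace HQ Q]
  {F : Type*} [NormedAddCommGroup F] [NormedSpace ℝ F]
  {A : Q → Type*} [TopologicalSpace (TotalSpace F A)]
  [∀ q, AddCommGroup (A q)] [∀ q, Module ℝ (A q)] [∀ q, TopologicalSpace (A q)]
  [∀ q, IsTopologicalAddGroup (A q)] [∀ q, ContinuousSMul ℝ (A q)]
  [FiberBundle F A] [VectorBundle ℝ F A]

/-- The fiber coordinate of `A*` in the trivialization at `q₀`. -/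
def dualCoord (q₀ : Q) (p : DualTotal F A) : F →L[ℝ] ℝ :=
  (trivializationAt (F →L[ℝ] ℝ) (fun q ↦ A q →L[ℝ] ℝ) q₀ p).2

theorem dualCoord_apply (q₀ : Q) (p : DualTotal F A) (v : F) :
    dualCoord q₀ p v = p.2 ((trivializationAt F A q₀).symmL ℝ p.1 v) := by
  have h := hom_trivializationAt_apply (σ := RingHom.id ℝ) (F₁ := F) (E₁ := A) (F₂ := ℝ)
    (E₂ := Bundle.Trivial Q ℝ) q₀ p
  unfold dualCoord
  refine (congrArg (fun z : Q × (F →L[ℝ] ℝ) ↦ z.2 v) h).trans ?_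
  change ContinuousLinearMap.inCoordinates F A ℝ (Bundle.Trivial Q ℝ) q₀ p.1 q₀ p.1 p.2 v = _
  unfold ContinuousLinearMap.inCoordinates
  simp

theorem dual_baseSet (q₀ : Q) :
    (trivializationAt (F →L[ℝ] ℝ) (fun q ↦ A q →L[ℝ] ℝ) q₀).baseSet =
      (trivializationAt F A q₀).baseSet := by
  refine (hom_trivializationAt_baseSet (σ := RingHom.id ℝ) (F₁ := F) (E₁ := A) (F₂ := ℝ)
    (E₂ := Bundle.Trivial Q ℝ) q₀).trans ?_
  exact Set.inter_univ _

theorem dualCoord_injOn {q₀ q : Q} (hq : q ∈ (trivializationAt F A q₀).baseSet)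
    {α β : A q →L[ℝ] ℝ} (h : dualCoord q₀ ⟨q, α⟩ = dualCoord (F := F) q₀ ⟨q, β⟩) : α = β := by
  ext v
  have := DFunLike.congr_fun h ((trivializationAt F A q₀).continuousLinearMapAt ℝ q v)
  rw [dualCoord_apply, dualCoord_apply] at this
  rwa [Trivialization.symmL_continuousLinearMapAt _ hq] at this

theorem dualCoord_smul (q₀ q : Q) (c : ℝ) (α : A q →L[ℝ] ℝ) :
    dualCoord (F := F) q₀ ⟨q, c • α⟩ = c • dualCoord q₀ ⟨q, α⟩ := by
  ext v
  simp [dualCoord_apply]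

theorem dualCoord_eq_zero_iff {q₀ : Q} {p : DualTotal F A}
    (hq : p.1 ∈ (trivializationAt F A q₀).baseSet) : dualCoord q₀ p = 0 ↔ p.2 = 0 := by
  constructor
  · intro h
    refine dualCoord_injOn (F := F) hq ?_
    rw [show (⟨p.1, p.2⟩ : DualTotal F A) = p from rfl, h]
    ext v; simp [dualCoord_apply]
  · intro h
    ext v; simp [dualCoord_apply, h]

instance dualTotal_t2Space [T2Space Q] : T2Space (DualTotal F A) := by
  refine ⟨fun p p' hpp ↦ ?_⟩
  have hproj : Continuous (TotalSpace.proj : DualTotal F A → Q) :=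
    FiberBundle.continuous_proj (F →L[ℝ] ℝ) (fun q ↦ A q →L[ℝ] ℝ)
  by_cases h : p.1 = p'.1
  · obtain ⟨q, α⟩ := p
    obtain ⟨q', β⟩ := p'
    obtain rfl : q = q' := h
    set e := trivializationAt (F →L[ℝ] ℝ) (fun q ↦ A q →L[ℝ] ℝ) q
    have hs : ∀ α, (⟨q, α⟩ : DualTotal F A) ∈ e.source := fun α ↦
      e.mem_source.mpr (FiberBundle.mem_baseSet_trivializationAt' q)
    have hne : e ⟨q, α⟩ ≠ e ⟨q, β⟩ := fun h ↦ hpp (e.injOn (hs α) (hs β) h)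
    obtain ⟨u, v, hu, hv, hxu, hxv, huv⟩ := t2_separation hne
    refine ⟨e.source ∩ e ⁻¹' u, e.source ∩ e ⁻¹' v,
      e.continuousOn.isOpen_inter_preimage e.open_source hu,
      e.continuousOn.isOpen_inter_preimage e.open_source hv, ⟨hs α, hxu⟩, ⟨hs β, hxv⟩, ?_⟩
    exact (huv.preimage e).mono Set.inter_subset_right Set.inter_subset_right
  · obtain ⟨u, v, hu, hv, hxu, hxv, huv⟩ := t2_separation h
    exact ⟨_, _, hu.preimage hproj, hv.preimage hproj, hxu, hxv, huv.preimage _⟩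

/-- Fiberwise multiplication by `c` in `A*`. -/
def fiberScale (c : ℝ) (p : DualTotal F A) : DualTotal F A := ⟨p.1, c • p.2⟩

theorem fiberScale_fiberScale (c d : ℝ) (p : DualTotal F A) :
    fiberScale c (fiberScale d p) = fiberScale (c * d) p := by
  unfold fiberScale
  rw [mul_smul]

theorem fiberScale_one (p : DualTotal F A) : fiberScale 1 p = p := by
  simp [fiberScale]

theorem contMDiffAt_dualCoord [IsManifold I ∞ Q] [ContMDiffVectorBundle ∞ F A I] {q₀ : Q}
    {p : DualTotal F A} (hq : p.1 ∈ (trivializationAt F A q₀).baseSet) :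
    ContMDiffAt (dualModel I F) 𝓘(ℝ, F →L[ℝ] ℝ) ∞ (dualCoord q₀) p := by
  have hps : p ∈ (trivializationAt (F →L[ℝ] ℝ) (fun q ↦ A q →L[ℝ] ℝ) q₀).source := by
    rw [Trivialization.mem_source, dual_baseSet]; exact hq
  have h := (Trivialization.contMDiffOn (IB := I) (n := ∞)
    (trivializationAt (F →L[ℝ] ℝ) (fun q ↦ A q →L[ℝ] ℝ) q₀)).contMDiffAt
      ((trivializationAt (F →L[ℝ] ℝ) (fun q ↦ A q →L[ℝ] ℝ) q₀).open_source.mem_nhds hps)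
  exact contMDiffAt_snd.comp p h

/-- A map into `A*` is smooth at a point if its base point and its fiber coordinate are. -/
theorem contMDiffAt_dualTotal {EN : Type*} [NormedAddCommGroup EN] [NormedSpace ℝ EN]
    {HN : Type*} [TopologicalSpace HN] {J : ModelWithCorners ℝ EN HN}
    {N : Type*} [TopologicalSpace N] [ChartedSpace HN N] {f : N → DualTotal F A} {x : N}
    (h1 : ContMDiffAt J I ∞ (fun y ↦ (f y).1) x)
    (h2 : ContMDiffAt J 𝓘(ℝ, F →L[ℝ] ℝ) ∞ (fun y ↦ dualCoord (f x).1 (f y)) x) :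
    ContMDiffAt J (dualModel I F) ∞ f x :=
  (Bundle.contMDiffAt_totalSpace (F := F →L[ℝ] ℝ) (E := fun q ↦ A q →L[ℝ] ℝ)).2 ⟨h1, h2⟩

theorem contMDiff_fiberScale [IsManifold I ∞ Q] [ContMDiffVectorBundle ∞ F A I] :
    ContMDiff (𝓘(ℝ, ℝ).prod (dualModel I F)) (dualModel I F) ∞
      (fun z : ℝ × DualTotal F A ↦ fiberScale z.1 z.2) := by
  rintro ⟨c, p⟩
  have hsnd : ContMDiffAt (𝓘(ℝ, ℝ).prod (dualModel I F)) (dualModel I F) ∞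
    (Prod.snd : ℝ × DualTotal F A → DualTotal F A) (c, p) := contMDiffAt_snd
  have hp := FiberBundle.mem_baseSet_trivializationAt' (F := F) (E := A) p.1
  refine contMDiffAt_dualTotal ?_ ?_
  · exact ContMDiffAt.comp (f := Prod.snd) (c, p)
      (Bundle.contMDiff_proj (IB := I) (F := F →L[ℝ] ℝ) (fun q ↦ A q →L[ℝ] ℝ)).contMDiffAt hsnd
  · have h : (fun z : ℝ × DualTotal F A ↦ dualCoord p.1 (fiberScale z.1 z.2)) =
        fun z ↦ z.1 • dualCoord p.1 z.2 := funext fun z ↦ dualCoord_smul _ _ _ _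
    refine ContMDiffAt.congr_of_eventuallyEq ?_ (Filter.EventuallyEq.of_eq h)
    have h2 : ContMDiffAt (𝓘(ℝ, ℝ).prod (dualModel I F)) 𝓘(ℝ, F →L[ℝ] ℝ) ∞
      (fun z : ℝ × DualTotal F A ↦ dualCoord p.1 z.2) (c, p) :=
      ContMDiffAt.comp (f := Prod.snd) (c, p) (contMDiffAt_dualCoord hp) hsnd
    exact contMDiffAt_fst.smul h2

section Metric

variable (g : ContMDiffRiemannianMetric I ∞ F A)

/-- The metric `g` in the trivialization of `A` at `q₀`, as a map from `F` to its dual. -/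
def metricCoord (q₀ q : Q) : F →L[ℝ] F →L[ℝ] ℝ :=
  ContinuousLinearMap.inCoordinates F A (F →L[ℝ] ℝ) (fun q ↦ A q →L[ℝ] ℝ) q₀ q q₀ q (g.inner q)

theorem metricCoord_apply {q₀ q : Q} (hq : q ∈ (trivializationAt F A q₀).baseSet) (v w : F) :
    metricCoord g q₀ q v w = g.inner q ((trivializationAt F A q₀).symmL ℝ q v)
      ((trivializationAt F A q₀).symmL ℝ q w) := by
  have h := inCoordinates_apply_eq₂ (F₁ := F) (E₁ := A) (F₂ := F) (E₂ := A) (F₃ := ℝ)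
    (E₃ := Bundle.Trivial Q ℝ) (ϕ := g.inner q) (v := v) (w := w) hq hq
    (by trivial)
  unfold metricCoord
  refine h.trans ?_
  rw [Trivialization.symmL_apply _ hq, Trivialization.symmL_apply _ hq]
  simp

theorem contMDiffAt_metricCoord (q₀ : Q) :
    ContMDiffAt I 𝓘(ℝ, F →L[ℝ] F →L[ℝ] ℝ) ∞ (metricCoord g q₀) q₀ :=
  ((contMDiffAt_hom_bundle _).1 (g.contMDiff q₀)).2

theorem isInvertible_metricCoord [FiniteDimensional ℝ F] {q₀ q : Q}
    (hq : q ∈ (trivializationAt F A q₀).baseSet) : (metricCoord g q₀ q).IsInvertible := by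
  have hinj : Function.Injective (metricCoord g q₀ q : F →ₗ[ℝ] F →L[ℝ] ℝ) := by
    rw [injective_iff_map_eq_zero]
    intro v hv
    by_contra h0
    have h1 : (trivializationAt F A q₀).symmL ℝ q v ≠ 0 := fun h ↦ h0 <| by
      rw [← Trivialization.continuousLinearMapAt_symmL (R := ℝ) (trivializationAt F A q₀) hq v, h,
        map_zero]
    have h2 := g.pos q _ h1
    rw [← metricCoord_apply g hq] at h2
    have h3 : metricCoord g q₀ q v = 0 := hv
    rw [h3] at h2
    simp at h2
  have hdim : finrank ℝ F = finrank ℝ (F →L[ℝ] ℝ) := by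
    rw [← (LinearMap.toContinuousLinearMap : (F →ₗ[ℝ] ℝ) ≃ₗ[ℝ] F →L[ℝ] ℝ).finrank_eq]
    exact Subspace.dual_finrank_eq.symm
  exact ⟨(LinearEquiv.ofInjectiveOfFinrankEq _ hinj hdim).toContinuousLinearEquiv, by ext; rfl⟩

theorem isInvertible_metric [FiniteDimensional ℝ F] (q : Q) : (g.inner q).IsInvertible := by
  have hq := FiberBundle.mem_baseSet_trivializationAt' (F := F) (E := A) q
  have h := isInvertible_metricCoord g hq
  unfold metricCoord at h
  rw [ContinuousLinearMap.inCoordinates_eq hq (by rw [dual_baseSet]; exact hq)] at h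
  simpa using h

theorem inner_metricSharp [FiniteDimensional ℝ F] {q : Q} (α : A q →L[ℝ] ℝ) :
    g.inner q (metricSharp g α) = α :=
  (isInvertible_metric g q).self_apply_inverse α

theorem kineticEnergy_eq [FiniteDimensional ℝ F] (p : DualTotal F A) :
    kineticEnergy g p = p.2 (metricSharp g p.2) / 2 := by
  rw [kineticEnergy, inner_metricSharp]

theorem kineticEnergy_fiberScale (c : ℝ) (p : DualTotal F A) :
    kineticEnergy g (fiberScale c p) = c ^ 2 * kineticEnergy g p := by
  obtain ⟨q, α⟩ := p
  have h : metricSharp g (c • α) = c • metricSharp g α := map_smul (g.inner q).inverse c α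
  change g.inner q (metricSharp g (c • α)) (metricSharp g (c • α)) / 2 =
    c ^ 2 * (g.inner q (metricSharp g α) (metricSharp g α) / 2)
  rw [h, map_smul, map_smul, smul_apply]
  simp only [smul_eq_mul]
  ring

theorem kineticEnergy_pos [FiniteDimensional ℝ F] {p : DualTotal F A} (hp : p.2 ≠ 0) :
    0 < kineticEnergy g p := by
  have h : metricSharp g p.2 ≠ 0 := fun h ↦ hp <| by
    rw [← inner_metricSharp g p.2, h, map_zero]
  have := g.pos p.1 _ h
  unfold kineticEnergy
  linarith

theorem kineticEnergy_eq_zero {p : DualTotal F A} (hp : p.2 = 0) :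
    kineticEnergy g p = 0 := by
  simp [kineticEnergy, metricSharp, hp]

theorem kineticEnergy_eq_coord [FiniteDimensional ℝ F] {q₀ : Q} {p : DualTotal F A}
    (hq : p.1 ∈ (trivializationAt F A q₀).baseSet) : kineticEnergy g p =
      dualCoord q₀ p ((metricCoord g q₀ p.1).inverse (dualCoord q₀ p)) / 2 := by
  have h : metricSharp g p.2 = (trivializationAt F A q₀).symmL ℝ p.1
      ((metricCoord g q₀ p.1).inverse (dualCoord q₀ p)) := by
    refine ((isInvertible_metric g p.1).inverse_apply_eq).2 ?_
    refine dualCoord_injOn (F := F) hq ?_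
    ext w
    rw [dualCoord_apply, dualCoord_apply]
    change _ = g.inner p.1 _ _
    rw [← metricCoord_apply g hq, (isInvertible_metricCoord g hq).self_apply_inverse,
      dualCoord_apply]
  rw [kineticEnergy_eq, h, dualCoord_apply]

theorem contMDiff_kineticEnergy [FiniteDimensional ℝ F] [IsManifold I ∞ Q]
    [ContMDiffVectorBundle ∞ F A I] :
    ContMDiff (dualModel I F) 𝓘(ℝ, ℝ) ∞ (kineticEnergy g) := by
  intro p
  have hp := FiberBundle.mem_baseSet_trivializationAt' (F := F) (E := A) p.1
  have hproj : ContMDiffAt (dualModel I F) I ∞ (TotalSpace.proj : DualTotal F A → Q) p :=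
    (Bundle.contMDiff_proj (IB := I) (F := F →L[ℝ] ℝ) (fun q ↦ A q →L[ℝ] ℝ)).contMDiffAt
  have hG := (contMDiffAt_metricCoord g p.1).comp p hproj
  have hinv := (isInvertible_metricCoord g hp).contDiffAt_map_inverse (n := ∞)
  have hGi : ContMDiffAt (dualModel I F) 𝓘(ℝ, (F →L[ℝ] ℝ) →L[ℝ] F) ∞
      (fun p' : DualTotal F A ↦ (metricCoord g p.1 p'.1).inverse) p :=
    ContMDiffAt.comp p (g := ContinuousLinearMap.inverse) hinv.contMDiffAt hG
  have hY := contMDiffAt_dualCoord (I := I) hp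
  have h := hY.clm_apply (hGi.clm_apply hY)
  have h2 := (contMDiffAt_const (c := (2 : ℝ)⁻¹)).mul h
  refine h2.congr_of_eventuallyEq ?_
  have hn : ∀ᶠ p' : DualTotal F A in 𝓝 p, p'.1 ∈ (trivializationAt F A p.1).baseSet :=
    hproj.continuousAt.eventually ((trivializationAt F A p.1).open_baseSet.mem_nhds hp)
  filter_upwards [hn] with p' hp'
  rw [kineticEnergy_eq_coord g hp']
  change _ = (2 : ℝ)⁻¹ * _
  rw [div_eq_inv_mul]

end Metric

end DualBundleGeometry

/-! ### Homogeneity of linear Poisson structures -/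

section LinearPoisson

variable {EQ : Type*} [NormedAddCommGroup EQ] [NormedSpace ℝ EQ]
  {HQ : Type*} [TopologicalSpace HQ] {I : ModelWithCorners ℝ EQ HQ}
  {Q : Type*} [TopologicalSpace Q] [ChartedSpace HQ Q]
  {F : Type*} [NormedAddCommGroup F] [NormedSpace ℝ F]
  {A : Q → Type*} [TopologicalSpace (TotalSpace F A)]
  [∀ q, AddCommGroup (A q)] [∀ q, Module ℝ (A q)] [∀ q, TopologicalSpace (A q)]
  [∀ q, IsTopologicalAddGroup (A q)] [∀ q, ContinuousSMul ℝ (A q)]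
  [FiberBundle F A] [VectorBundle ℝ F A]

theorem contMDiff_dualProj :
    ContMDiff (dualModel I F) I ∞ (TotalSpace.proj : DualTotal F A → Q) :=
  Bundle.contMDiff_proj (IB := I) (F := F →L[ℝ] ℝ) (fun q ↦ A q →L[ℝ] ℝ)

theorem eventually_mem_baseSet (p : DualTotal F A) :
    ∀ᶠ p' : DualTotal F A in 𝓝 p, p'.1 ∈ (trivializationAt F A p.1).baseSet :=
  (FiberBundle.continuous_proj (F →L[ℝ] ℝ) (fun q ↦ A q →L[ℝ] ℝ)).continuousAt.eventually
    ((trivializationAt F A p.1).open_baseSet.mem_nhds (FiberBundle.mem_baseSet_trivializationAt' _))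

theorem dual_extChartAt_eventuallyEq (p : DualTotal F A) :
    (extChartAt (dualModel I F) p : DualTotal F A → EQ × (F →L[ℝ] ℝ)) =ᶠ[𝓝 p]
      fun p' ↦ (extChartAt I p.1 p'.1, dualCoord p.1 p') := by
  filter_upwards [eventually_mem_baseSet p] with p' hp'
  rw [FiberBundle.extChartAt]
  have hps : p' ∈ (trivializationAt (F →L[ℝ] ℝ) (fun q ↦ A q →L[ℝ] ℝ) p.1).source := by
    rw [Trivialization.mem_source, dual_baseSet]; exact hp'
  have h := Trivialization.coe_fst _ hps
  simp only [PartialEquiv.coe_trans, Function.comp_apply, PartialEquiv.prod_coe,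
    PartialEquiv.refl_coe, id]
  refine Prod.ext ?_ rfl
  exact congrArg (extChartAt I p.1) h

variable [IsManifold I ∞ Q] [ContMDiffVectorBundle ∞ F A I]

theorem contMDiff_fiberScale_const (c : ℝ) :
    ContMDiff (dualModel I F) (dualModel I F) ∞ (fiberScale (F := F) (A := A) c) :=
  contMDiff_fiberScale.comp (contMDiff_const.prodMk contMDiff_id)

theorem contMDiff_fiberScale_curve {h : ℝ → ℝ} (hh : ContDiff ℝ ∞ h) (p : DualTotal F A) :
    ContMDiff 𝓘(ℝ, ℝ) (dualModel I F) ∞ (fun t ↦ fiberScale (h t) p) :=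
  contMDiff_fiberScale.comp (hh.contMDiff.prodMk contMDiff_const)

theorem lieDerivFun_liouville {f : DualTotal F A → ℝ}
    (hf : ContMDiff (dualModel I F) 𝓘(ℝ, ℝ) ∞ f) (p : DualTotal F A) :
    lieDerivFun (dualModel I F) (liouville I F A) f p = deriv (fun t ↦ f (fiberScale (1 + t) p)) 0 := by
  have h1 := contMDiff_mdifferentiableAt
    (contMDiff_fiberScale_curve (I := I) (contDiff_const.add contDiff_id : ContDiff ℝ ∞
      fun t : ℝ ↦ (1 : ℝ) + t) p) 0
  have hp : fiberScale (1 + 0) p = p := by rw [add_zero, fiberScale_one]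
  have h2 : MDifferentiableAt (dualModel I F) 𝓘(ℝ, ℝ) f (fiberScale (1 + 0) p) :=
    contMDiff_mdifferentiableAt hf _
  have h := mfderiv_comp_apply_of_eq (y := p) (x := (0 : ℝ)) (contMDiff_mdifferentiableAt hf p) h1
    hp (1 : ℝ)
  rw [mfderiv_eq_fderiv] at h
  exact h.symm

theorem lieDerivFun_liouville_of_homogeneous {f : DualTotal F A → ℝ}
    (hf : ContMDiff (dualModel I F) 𝓘(ℝ, ℝ) ∞ f) {n : ℕ}
    (hn : ∀ c p, f (fiberScale c p) = c ^ n * f p) (p : DualTotal F A) :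
    lieDerivFun (dualModel I F) (liouville I F A) f p = n * f p := by
  rw [lieDerivFun_liouville hf]
  simp only [hn]
  have h : HasDerivAt (fun t : ℝ ↦ (1 + t) ^ n * f p)
      ((n * (1 + 0) ^ (n - 1) * 1) * f p) 0 :=
    (((hasDerivAt_id (0 : ℝ)).const_add 1).pow n).mul_const _
  rw [h.deriv]
  simp

theorem contMDiff_lieDerivFun_liouville {f : DualTotal F A → ℝ}
    (hf : ContMDiff (dualModel I F) 𝓘(ℝ, ℝ) ∞ f) :
    ContMDiff (dualModel I F) 𝓘(ℝ, ℝ) ∞ (lieDerivFun (dualModel I F) (liouville I F A) f) := by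
  intro p₀
  have hF : ContMDiff ((dualModel I F).prod 𝓘(ℝ, ℝ)) 𝓘(ℝ, ℝ) ∞
      (Function.uncurry fun (p : DualTotal F A) (t : ℝ) ↦ f (fiberScale (1 + t) p)) :=
    hf.comp (contMDiff_fiberScale.comp
      ((contMDiff_const.add contMDiff_snd : ContMDiff ((dualModel I F).prod 𝓘(ℝ, ℝ)) 𝓘(ℝ, ℝ) ∞
        fun z : DualTotal F A × ℝ ↦ (1 : ℝ) + z.2).prodMk contMDiff_fst))
  have h := ContMDiffAt.mfderiv (x₀ := p₀) (fun (p : DualTotal F A) (t : ℝ) ↦ f (fiberScale (1 + t) p))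
    (fun _ ↦ (0 : ℝ)) (hF _) (contMDiffAt_const) (m := ∞) (by norm_cast)
  have h2 := h.clm_apply (contMDiffAt_const (c := (1 : ℝ)))
  refine h2.congr_of_eventuallyEq (Filter.Eventually.of_forall fun p ↦ ?_)
  rw [lieDerivFun_liouville hf]
  simp only [inTangentCoordinates_model_space, mfderiv_eq_fderiv]
  rfl

/-- The velocity of the curve `s ↦ e^s p` is the value of the Liouville vector field, transported from
`p` by the multiplication by `e^t`. -/
theorem mfderiv_fiberScale_exp (p : DualTotal F A) (t : ℝ) :
    (mfderiv 𝓘(ℝ, ℝ) (dualModel I F) (fun s : ℝ ↦ fiberScale (Real.exp s) p) t :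
      ℝ →L[ℝ] EQ × (F →L[ℝ] ℝ)) 1 =
    (mfderiv (dualModel I F) (dualModel I F) (fiberScale (Real.exp t)) p :
      EQ × (F →L[ℝ] ℝ) →L[ℝ] EQ × (F →L[ℝ] ℝ)) (liouville I F A p) := by
  -- near `s = t`, the curve is `e^t` times the curve `1 + r` with `r = e^(s - t) - 1`
  let h : ℝ → ℝ := fun s ↦ Real.exp (s - t) - 1
  let c : ℝ → DualTotal F A := fun r ↦ fiberScale (1 + r) p
  have hh : HasDerivAt h 1 t := by
    have := (((hasDerivAt_id t).sub_const t).exp).sub_const 1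
    simp only [id, sub_self, Real.exp_zero, mul_one] at this
    exact this
  have hht : h t = 0 := by simp [h]
  have hc : MDifferentiableAt 𝓘(ℝ, ℝ) (dualModel I F) c 0 := contMDiff_mdifferentiableAt
    (contMDiff_fiberScale_curve (I := I) (contDiff_const.add contDiff_id : ContDiff ℝ ∞
      fun t : ℝ ↦ (1 : ℝ) + t) p) 0
  have hc0 : c 0 = p := by simp only [c]; rw [add_zero, fiberScale_one]
  have hdh : MDifferentiableAt 𝓘(ℝ, ℝ) 𝓘(ℝ, ℝ) h t := hh.differentiableAt.mdifferentiableAt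
  have hch : MDifferentiableAt 𝓘(ℝ, ℝ) (dualModel I F) (c ∘ h) t :=
    MDifferentiableAt.comp t (hht ▸ hc) hdh
  have hm := contMDiff_mdifferentiableAt (contMDiff_fiberScale_const (I := I) (F := F) (A := A)
    (Real.exp t)) p
  have e : (fun s : ℝ ↦ fiberScale (Real.exp s) p) = fiberScale (Real.exp t) ∘ (c ∘ h) := by
    funext s
    simp only [c, h, Function.comp_apply]
    rw [fiberScale_fiberScale, add_sub_cancel, ← Real.exp_add, add_sub_cancel]
  rw [e]
  refine (mfderiv_comp_apply_of_eq (x := t) (y := p) hm hch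
    (by rw [Function.comp_apply, hht, hc0]) (1 : ℝ)).trans ?_
  congr 1
  refine (mfderiv_comp_apply_of_eq (x := t) (y := (0 : ℝ)) hc hdh hht (1 : ℝ)).trans ?_
  have h1 : (mfderiv 𝓘(ℝ, ℝ) 𝓘(ℝ, ℝ) h t : ℝ →L[ℝ] ℝ) 1 = 1 := by
    rw [mfderiv_eq_fderiv, hh.hasFDerivAt.fderiv]
    exact one_mul (1 : ℝ)
  exact congrArg (mfderiv 𝓘(ℝ, ℝ) (dualModel I F) c 0 : ℝ →L[ℝ] EQ × (F →L[ℝ] ℝ)) h1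

/-- Away from the zero section, every covector of `A*` is the differential of a fiberwise linear
function. -/
theorem exists_isFiberwiseLinear_differential_eq [FiniteDimensional ℝ EQ] [T2Space Q]
    [I.Boundaryless] [FiniteDimensional ℝ F]
    {p : DualTotal F A} (hp : p.2 ≠ 0) (ξ : Cotangent (dualModel I F) p) :
    ∃ G : DualTotal F A → ℝ, ContMDiff (dualModel I F) 𝓘(ℝ, ℝ) ∞ G ∧ IsFiberwiseLinear G ∧
      differential (dualModel I F) G p = ξ := by
  obtain ⟨q₀, α⟩ := p
  have hq₀ := FiberBundle.mem_baseSet_trivializationAt' (F := F) (E := A) q₀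
  set y₀ : F →L[ℝ] ℝ := dualCoord q₀ (⟨q₀, α⟩ : DualTotal F A) with hy₀
  have hy0 : y₀ ≠ 0 := fun h ↦ hp ((dualCoord_eq_zero_iff hq₀).1 h)
  obtain ⟨v, hv⟩ : ∃ v, y₀ v = 1 := by
    obtain ⟨v, hv⟩ := DFunLike.exists_ne hy0
    exact ⟨(y₀ v)⁻¹ • v, by
      rw [map_smul, smul_eq_mul]; exact inv_mul_cancel₀ hv⟩
  let ξ' : EQ × (F →L[ℝ] ℝ) →ₗ[ℝ] ℝ := ξ
  let l : EQ →L[ℝ] ℝ := (ξ' ∘ₗ LinearMap.inl ℝ EQ (F →L[ℝ] ℝ)).toContinuousLinearMap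
  obtain ⟨a, ha⟩ : ∃ a : F, ∀ η : F →L[ℝ] ℝ, ξ' (0, η) = η a := by
    let μ : Dual ℝ (Dual ℝ F) := ξ' ∘ₗ LinearMap.inr ℝ EQ (F →L[ℝ] ℝ) ∘ₗ
      (LinearMap.toContinuousLinearMap : (F →ₗ[ℝ] ℝ) ≃ₗ[ℝ] F →L[ℝ] ℝ).toLinearMap
    refine ⟨(evalEquiv ℝ F).symm μ, fun η ↦ ?_⟩
    have h := LinearMap.congr_fun ((evalEquiv ℝ F).apply_symm_apply μ) η.toLinearMap
    rw [evalEquiv_apply] at h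
    exact h.symm
  have hbs : (trivializationAt F A q₀).baseSet ∩ (chartAt HQ q₀).source ∈ 𝓝 q₀ :=
    Filter.inter_mem ((trivializationAt F A q₀).open_baseSet.mem_nhds hq₀)
      ((chartAt HQ q₀).open_source.mem_nhds (mem_chart_source HQ q₀))
  obtain ⟨ψ, -, hψ⟩ := (SmoothBumpFunction.nhds_basis_tsupport (I := I) q₀).mem_iff.1 hbs
  set x₀ := extChartAt I q₀ q₀ with hx₀
  let w : Q → F := fun q ↦ a + l (extChartAt I q₀ q - x₀) • v
  -- in coordinates `(x, y)` near `p = (x₀, y₀)` this is `y(a) + l(x - x₀) y(v)`, where `y₀(v) = 1`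
  refine ⟨fun p ↦ ψ p.1 * dualCoord q₀ p (w p.1), ?_, ?_, ?_⟩
  · intro p
    have hπ := contMDiff_dualProj (I := I) (F := F) (A := A) p
    by_cases h : p.1 ∈ tsupport ψ
    · have hc : ContMDiffAt (dualModel I F) 𝓘(ℝ, EQ) ∞
          (fun p : DualTotal F A ↦ extChartAt I q₀ p.1) p :=
        ContMDiffAt.comp p (contMDiffAt_extChartAt' (hψ h).2) hπ
      have hl : ContMDiffAt (dualModel I F) 𝓘(ℝ, ℝ) ∞
          (fun p : DualTotal F A ↦ l (extChartAt I q₀ p.1 - x₀)) p :=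
        ContMDiffAt.comp p l.contDiff.contMDiff.contMDiffAt (hc.sub contMDiffAt_const)
      have hw : ContMDiffAt (dualModel I F) 𝓘(ℝ, F) ∞ (fun p : DualTotal F A ↦ w p.1) p :=
        contMDiffAt_const.add (hl.smul contMDiffAt_const)
      exact (ContMDiffAt.comp p ψ.contMDiffAt hπ).mul
        ((contMDiffAt_dualCoord (hψ h).1).clm_apply hw)
    · have hev : ∀ᶠ p' : DualTotal F A in 𝓝 p, p'.1 ∉ tsupport ψ :=
        hπ.continuousAt.eventually ((isClosed_tsupport ψ).isOpen_compl.mem_nhds h)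
      refine (contMDiffAt_const (c := (0 : ℝ))).congr_of_eventuallyEq ?_
      filter_upwards [hev] with p' hp'
      rw [image_eq_zero_of_notMem_tsupport hp', zero_mul]
  · intro q
    refine ⟨fun α β ↦ ?_, fun c α ↦ ?_⟩
    · simp only [dualCoord_apply]
      change _ * (α _ + β _) = _
      ring
    · simp only [dualCoord_apply]
      change _ * (c * α _) = c * _
      ring
  · let R : EQ × (F →L[ℝ] ℝ) → ℝ := fun z ↦ z.2 (a + l (z.1 - x₀) • v)
    have hG : (fun p : DualTotal F A ↦ ψ p.1 * dualCoord q₀ p (w p.1)) =ᶠ[𝓝 ⟨q₀, α⟩]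
        R ∘ extChartAt (dualModel I F) (⟨q₀, α⟩ : DualTotal F A) := by
      have hπ : ContinuousAt (TotalSpace.proj : DualTotal F A → Q) ⟨q₀, α⟩ :=
        (FiberBundle.continuous_proj (F →L[ℝ] ℝ) (fun q ↦ A q →L[ℝ] ℝ)).continuousAt
      filter_upwards [hπ.eventually ψ.eventuallyEq_one,
        dual_extChartAt_eventuallyEq (I := I) (⟨q₀, α⟩ : DualTotal F A)]
        with p h1 h2
      rw [Function.comp_apply, h2, h1]
      exact one_mul _
    have hx : extChartAt (dualModel I F) (⟨q₀, α⟩ : DualTotal F A) ⟨q₀, α⟩ = (x₀, y₀) :=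
      (dual_extChartAt_eventuallyEq (I := I) (⟨q₀, α⟩ : DualTotal F A)).eq_of_nhds
    have hR : HasFDerivAt R _ (x₀, y₀) :=
      (hasFDerivAt_snd (𝕜 := ℝ) (p := (x₀, y₀))).clm_apply
        (((l.hasFDerivAt.comp (x₀, y₀) ((hasFDerivAt_fst (𝕜 := ℝ) (p := (x₀, y₀))).sub_const x₀)).smul_const
          v).const_add a)
    rw [← hx] at hR
    ext z
    rw [differential_congr hG]
    refine (differential_comp_coordinates (x₀ := (⟨q₀, α⟩ : DualTotal F A))
      Filter.EventuallyEq.rfl hR z).trans ?_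
    have key : ∀ (x : EQ) (η : F →L[ℝ] ℝ), y₀ (l x • v) + η (a + l (x₀ - x₀) • v) = ξ' (x, η) := by
      intro x η
      rw [map_smul, hv, sub_self, map_zero, zero_smul, add_zero, ← ha, smul_eq_mul, mul_one]
      change ξ' (x, 0) + _ = _
      rw [← map_add]
      simp
    rw [hx]
    exact key z.1 z.2

section Homogeneity

variable [FiniteDimensional ℝ EQ] [T2Space Q] [I.Boundaryless] [FiniteDimensional ℝ F]
  {P : CoBilinField (dualModel I F) (DualTotal F A)}

theorem IsFiberwiseLinear.fiberScale {G : DualTotal F A → ℝ} (hG : IsFiberwiseLinear G) (c : ℝ)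
    (p : DualTotal F A) : G (fiberScale c p) = c * G p :=
  (hG p.1).map_smul c p.2

/-- A linear Poisson structure is homogeneous of degree `-1` away from the zero section: it is
determined there by the brackets of the fiberwise linear functions. -/
theorem IsLinearPoissonStructure.apply_fiberScale (hP : IsLinearPoissonStructure I P) {c : ℝ}
    (hc : c ≠ 0) {p : DualTotal F A} (hp : p.2 ≠ 0)
    (α β : Cotangent (dualModel I F) (fiberScale c p)) :
    P p (covectorPullback (dualModel I F) (dualModel I F) (fiberScale c) p α)
      (covectorPullback (dualModel I F) (dualModel I F) (fiberScale c) p β) =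
    c * P (fiberScale c p) α β := by
  have hcp : (fiberScale c p).2 ≠ 0 := smul_ne_zero hc hp
  obtain ⟨G₁, hG₁, hl₁, rfl⟩ := exists_isFiberwiseLinear_differential_eq hcp α
  obtain ⟨G₂, hG₂, hl₂, rfl⟩ := exists_isFiberwiseLinear_differential_eq hcp β
  have hm := contMDiff_mdifferentiableAt (contMDiff_fiberScale_const (I := I) (F := F) (A := A) c) p
  have key : ∀ {G : DualTotal F A → ℝ}, ContMDiff (dualModel I F) 𝓘(ℝ, ℝ) ∞ G →
      IsFiberwiseLinear G → covectorPullback (dualModel I F) (dualModel I F) (fiberScale c) p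
        (differential (dualModel I F) G (fiberScale c p)) =
        c • differential (dualModel I F) G p := by
    intro G hG hl
    rw [← differential_comp (contMDiff_mdifferentiableAt hG _) hm,
      ← differential_const_mul c (contMDiff_mdifferentiableAt hG _)]
    congr 1
    exact funext fun p ↦ hl.fiberScale c p
  rw [key hG₁ hl₁, key hG₂ hl₂, map_smul, map_smul, LinearMap.smul_apply]
  have h := (hP.linear G₁ G₂ hG₁ hG₂ hl₁ hl₂).fiberScale c p
  change P (fiberScale c p) _ _ = c * P p _ _ at h
  rw [h, smul_eq_mul, smul_eq_mul]

theorem lieDerivFun_liouville_of_isFiberwiseLinear {G : DualTotal F A → ℝ}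
    (hG : ContMDiff (dualModel I F) 𝓘(ℝ, ℝ) ∞ G) (hl : IsFiberwiseLinear G) :
    lieDerivFun (dualModel I F) (liouville I F A) G = G := by
  funext p
  rw [lieDerivFun_liouville_of_homogeneous hG (n := 1) (by simpa using hl.fiberScale)]
  simp

/-- At a critical point of `r`, the Liouville vector field `Δ` and the Hamiltonian vector field `X_h`
commute on `r`, so that `Δ{h, r} = {h, Δ(r)}` there. Hence `Δ{h, f} - {h, Δ(f)}` depends only on the
first-order jet of `f`. -/
theorem lieDeriv_liouville_of_differential_eq_zero (hP : IsPoissonStructure (dualModel I F) P)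
    {r h : DualTotal F A → ℝ}
    (hr : ContMDiff (dualModel I F) 𝓘(ℝ, ℝ) ∞ r) (hh : ContMDiff (dualModel I F) 𝓘(ℝ, ℝ) ∞ h)
    {p : DualTotal F A} (h0 : differential (dualModel I F) r p = 0) :
    lieDerivFun (dualModel I F) (liouville I F A) (bivectorBracket (dualModel I F) P h r) p =
      bivectorBracket (dualModel I F) P h
        (lieDerivFun (dualModel I F) (liouville I F A) r) p := by
  have hX : ∀ f, lieDerivFun (dualModel I F) (hamiltonianVF (dualModel I F) P h) f =
      fun x ↦ -bivectorBracket (dualModel I F) P h f x :=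
    fun f ↦ funext fun x ↦ lieDerivFun_hamiltonianVF P h f x
  have hs := fun f (hf : ContMDiff (dualModel I F) 𝓘(ℝ, ℝ) ∞ f) ↦
    hP.isBivectorField.smooth h f hh hf
  have hc := lieDerivFun_comm_of_differential_eq_zero (V := liouville I F A)
    (W := hamiltonianVF (dualModel I F) P h)
    (fun f hf ↦ contMDiff_lieDerivFun_liouville hf) (fun f hf ↦ by rw [hX]; exact (hs f hf).neg)
    hr h0
  rw [hX, hX] at hc
  have e : lieDerivFun (dualModel I F) (liouville I F A)
      (fun x ↦ -bivectorBracket (dualModel I F) P h r x) p =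
      -lieDerivFun (dualModel I F) (liouville I F A) (bivectorBracket (dualModel I F) P h r) p := by
    unfold lieDerivFun
    rw [differential_neg (contMDiff_mdifferentiableAt (hs r hr) p)]
    rfl
  rw [e] at hc
  exact neg_injective hc

/-- `L_Δ P = -P` for a linear Poisson structure, away from the zero section. -/
theorem IsLinearPoissonStructure.lieDeriv_liouville_of_ne (hP : IsLinearPoissonStructure I P)
    {f h : DualTotal F A → ℝ} (hf : ContMDiff (dualModel I F) 𝓘(ℝ, ℝ) ∞ f)
    (hh : ContMDiff (dualModel I F) 𝓘(ℝ, ℝ) ∞ h) {p : DualTotal F A} (hp : p.2 ≠ 0) :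
    lieDerivFun (dualModel I F) (liouville I F A) (bivectorBracket (dualModel I F) P f h) p =
      bivectorBracket (dualModel I F) P (lieDerivFun (dualModel I F) (liouville I F A) f) h p +
      bivectorBracket (dualModel I F) P f (lieDerivFun (dualModel I F) (liouville I F A) h) p -
      bivectorBracket (dualModel I F) P f h p := by
  have hPP := hP.isPoissonStructure
  have halt := hPP.isBivectorField.alt
  set b := bivectorBracket (dualModel I F) P with hb
  set Δ := lieDerivFun (dualModel I F) (liouville I F A) with hΔ
  obtain ⟨G₁, hG₁, hl₁, hd₁⟩ := exists_isFiberwiseLinear_differential_eq hp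
    (differential (dualModel I F) f p)
  obtain ⟨G₂, hG₂, hl₂, hd₂⟩ := exists_isFiberwiseLinear_differential_eq hp
    (differential (dualModel I F) h p)
  have hDs : ∀ {f}, ContMDiff (dualModel I F) 𝓘(ℝ, ℝ) ∞ f →
    ContMDiff (dualModel I F) 𝓘(ℝ, ℝ) ∞ (Δ f) := fun hf ↦ contMDiff_lieDerivFun_liouville hf
  have hbs : ∀ {f g}, ContMDiff (dualModel I F) 𝓘(ℝ, ℝ) ∞ f →
    ContMDiff (dualModel I F) 𝓘(ℝ, ℝ) ∞ g → ContMDiff (dualModel I F) 𝓘(ℝ, ℝ) ∞ (b f g) :=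
    fun hf hg ↦ hPP.isBivectorField.smooth _ _ hf hg
  have hDsub : ∀ {f g}, ContMDiff (dualModel I F) 𝓘(ℝ, ℝ) ∞ f →
      ContMDiff (dualModel I F) 𝓘(ℝ, ℝ) ∞ g →
      Δ (fun x ↦ f x - g x) = fun x ↦ Δ f x - Δ g x := by
    intro f g hf hg
    funext x
    rw [hΔ]
    unfold lieDerivFun
    rw [differential_sub (contMDiff_mdifferentiableAt hf x) (contMDiff_mdifferentiableAt hg x)]
    rfl
  have hbsub : ∀ {k f g}, ContMDiff (dualModel I F) 𝓘(ℝ, ℝ) ∞ f →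
      ContMDiff (dualModel I F) 𝓘(ℝ, ℝ) ∞ g →
      b k (fun x ↦ f x - g x) = fun x ↦ b k f x - b k g x := by
    intro k f g hf hg
    funext x
    rw [hb]
    unfold bivectorBracket
    rw [differential_sub (contMDiff_mdifferentiableAt hf x) (contMDiff_mdifferentiableAt hg x),
      map_sub]
  have hz : ∀ {f g}, ContMDiff (dualModel I F) 𝓘(ℝ, ℝ) ∞ f →
      ContMDiff (dualModel I F) 𝓘(ℝ, ℝ) ∞ g →
      differential (dualModel I F) g p = differential (dualModel I F) f p →
      ∀ {k}, ContMDiff (dualModel I F) 𝓘(ℝ, ℝ) ∞ k →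
      Δ (b k f) p - Δ (b k g) p = b k (Δ f) p - b k (Δ g) p := by
    intro f g hf hg hd k hk
    have h0 : differential (dualModel I F) (fun x ↦ f x - g x) p = 0 := by
      rw [differential_sub (contMDiff_mdifferentiableAt hf p) (contMDiff_mdifferentiableAt hg p),
        hd, sub_self]
    have := lieDeriv_liouville_of_differential_eq_zero (P := P) hPP (hf.sub hg) hk h0
    change Δ (b k (fun x ↦ f x - g x)) p = b k (Δ (fun x ↦ f x - g x)) p at this
    rw [hbsub hf hg, hDsub (hbs hk hf) (hbs hk hg), hDsub hf hg, hbsub (hDs hf) (hDs hg)] at this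
    exact this
  -- reduction to fiberwise linear functions, first in the second argument, then in the first
  have hlin : Δ (b G₁ G₂) p = b G₁ G₂ p := congrFun (lieDerivFun_liouville_of_isFiberwiseLinear
    (hbs hG₁ hG₂) (hP.linear G₁ G₂ hG₁ hG₂ hl₁ hl₂)) p
  have e1 : Δ G₁ = G₁ := lieDerivFun_liouville_of_isFiberwiseLinear hG₁ hl₁
  have e2 : Δ G₂ = G₂ := lieDerivFun_liouville_of_isFiberwiseLinear hG₂ hl₂
  have hswap : ∀ f g x, b f g x = -b g f x := bivectorBracket_swap halt
  have hDswap : ∀ {f g}, ContMDiff (dualModel I F) 𝓘(ℝ, ℝ) ∞ f →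
      ContMDiff (dualModel I F) 𝓘(ℝ, ℝ) ∞ g → Δ (b f g) p = -Δ (b g f) p := by
    intro f g hf hg
    rw [show b f g = fun x ↦ -b g f x from funext (hswap f g), hΔ]
    unfold lieDerivFun
    rw [differential_neg (contMDiff_mdifferentiableAt (hbs hg hf) p)]
    rfl
  have h1 := hz hh hG₂ hd₂ hf
  have h2 := hz hf hG₁ hd₁ hG₂
  rw [hDswap hG₂ hf, hDswap hG₂ hG₁, hlin, hswap G₂ (Δ f), e1, hswap G₂ G₁] at h2
  rw [e2] at h1
  have hc : ∀ {f f' g g'}, differential (dualModel I F) f p = differential (dualModel I F) f' p →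
      differential (dualModel I F) g p = differential (dualModel I F) g' p → b f g p = b f' g' p := by
    intro f f' g g' h h'
    rw [hb]
    unfold bivectorBracket
    rw [h, h']
  have c1 : b G₁ G₂ p = b f h p := hc hd₁ hd₂
  have c2 : b f G₂ p = b f h p := hc rfl hd₂
  have c3 : b (Δ f) G₂ p = b (Δ f) h p := hc rfl hd₂
  linarith

theorem nontrivial_fiber [Nontrivial F] (q : Q) : ∃ α : A q →L[ℝ] ℝ, α ≠ 0 := by
  obtain ⟨v, hv⟩ := exists_ne (0 : F)
  obtain ⟨ℓ, hℓ⟩ : ∃ ℓ : F →L[ℝ] ℝ, ℓ v ≠ 0 := by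
    obtain ⟨ℓ, -, hℓ⟩ := exists_dual_vector ℝ v (norm_ne_zero_iff.2 hv)
    exact ⟨ℓ, by rw [hℓ]; simpa using hv⟩
  have hq := FiberBundle.mem_baseSet_trivializationAt' (F := F) (E := A) q
  refine ⟨ℓ.comp ((trivializationAt F A q).continuousLinearMapAt ℝ q), fun h ↦ hℓ ?_⟩
  have := DFunLike.congr_fun h ((trivializationAt F A q).symmL ℝ q v)
  simpa [Trivialization.continuousLinearMapAt_symmL _ hq] using this

/-- A smooth function on `A*` which vanishes away from the zero section vanishes everywhere, if the
rank is positive. -/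
theorem eq_zero_of_forall_ne [Nontrivial F] {f : DualTotal F A → ℝ}
    (hf : ContMDiff (dualModel I F) 𝓘(ℝ, ℝ) ∞ f)
    (h : ∀ p : DualTotal F A, p.2 ≠ 0 → f p = 0) (p : DualTotal F A) : f p = 0 := by
  by_cases hp : p.2 = 0
  -- a point of the zero section is the limit at `t = 0` of `t α`
  · obtain ⟨α, hα⟩ := nontrivial_fiber (F := F) (A := A) p.1
    have hcont : Continuous fun t : ℝ ↦ f (fiberScale t ⟨p.1, α⟩) :=
      hf.continuous.comp (contMDiff_fiberScale_curve (I := I) (contDiff_id (𝕜 := ℝ)) _).continuous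
    have h0 : fiberScale 0 (⟨p.1, α⟩ : DualTotal F A) = p := by
      obtain ⟨q, β⟩ := p
      change β = 0 at hp
      simp [fiberScale, hp]
    have hd : Dense ({0}ᶜ : Set ℝ) := dense_compl_singleton 0
    have := hcont.ext_on hd continuous_const (g := fun _ ↦ (0 : ℝ))
      fun t ht ↦ h _ (smul_ne_zero ht hα)
    rw [← h0]
    exact congrFun this 0
  · exact h p hp

/-- `L_Δ P = -P` for a linear Poisson structure, if the rank is positive. -/
theorem IsLinearPoissonStructure.lieDeriv_liouville [Nontrivial F]
    (hP : IsLinearPoissonStructure I P)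
    {f h : DualTotal F A → ℝ} (hf : ContMDiff (dualModel I F) 𝓘(ℝ, ℝ) ∞ f)
    (hh : ContMDiff (dualModel I F) 𝓘(ℝ, ℝ) ∞ h) (p : DualTotal F A) :
    lieDerivFun (dualModel I F) (liouville I F A) (bivectorBracket (dualModel I F) P f h) p =
      bivectorBracket (dualModel I F) P (lieDerivFun (dualModel I F) (liouville I F A) f) h p +
      bivectorBracket (dualModel I F) P f (lieDerivFun (dualModel I F) (liouville I F A) h) p -
      bivectorBracket (dualModel I F) P f h p := by
  have hs := hP.isPoissonStructure.isBivectorField.smooth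
  have hD := fun f hf ↦ contMDiff_lieDerivFun_liouville (I := I) (F := F) (A := A) (f := f) hf
  have hc := ((hD _ (hs f h hf hh)).sub
    (((hs _ h (hD f hf) hh).add (hs f _ hf (hD h hh))).sub (hs f h hf hh)))
  exact sub_eq_zero.1 (eq_zero_of_forall_ne hc
    (fun p hp ↦ sub_eq_zero.2 (hP.lieDeriv_liouville_of_ne hf hh hp)) p)

variable (g : ContMDiffRiemannianMetric I ∞ F A)

theorem lieDerivFun_liouville_kineticEnergy (p : DualTotal F A) :
    lieDerivFun (dualModel I F) (liouville I F A) (kineticEnergy g) p = 2 * kineticEnergy g p := by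
  rw [lieDerivFun_liouville_of_homogeneous (contMDiff_kineticEnergy g) (n := 2)
    (kineticEnergy_fiberScale g)]
  norm_num

/-- In rank zero the kinetic energy and the Liouville vector field vanish, and the pair is `(P, 0)`. In
this case `L_Δ P = 0`, so that the homogeneity of `P` is not available. -/
theorem isJacobiStructure_of_subsingleton [Subsingleton F] (hP : IsLinearPoissonStructure I P) :
    IsJacobiStructure (dualModel I F) (dualLambda P g) (dualReeb P g) := by
  have h2 : ∀ p : DualTotal F A, p.2 = 0 := fun p ↦
    (dualCoord_eq_zero_iff (FiberBundle.mem_baseSet_trivializationAt' (F := F) (E := A) p.1)).1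
      (Subsingleton.elim _ _)
  have hΔ : ∀ p : DualTotal F A, liouville I F A p = 0 := by
    intro p
    have : (fun t : ℝ ↦ (⟨p.1, (1 + t) • p.2⟩ : DualTotal F A)) = fun _ ↦ p := by
      funext t
      obtain ⟨q, α⟩ := p
      have hα : α = 0 := h2 ⟨q, α⟩
      simp [hα]
    unfold liouville
    rw [this, mfderiv_const]
    rfl
  have hκ : kineticEnergy g = fun _ : DualTotal F A ↦ (0 : ℝ) :=
    funext fun p ↦ kineticEnergy_eq_zero g (h2 p)
  have hX : ∀ p, kineticVF P g p = 0 := by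
    intro p
    unfold kineticVF hamiltonianVF
    rw [hκ, differential_const, map_zero, map_zero, neg_zero]
  have hL : dualLambda P g = P := by
    funext p
    unfold dualLambda
    rw [hX, hΔ]
    ext α β
    simp [vecWedge_apply]
  have hR : dualReeb P g = fun _ ↦ 0 := by
    funext p
    unfold dualReeb
    rw [hX, neg_zero]
  have hzero : ∀ f : DualTotal F A → ℝ, lieDerivFun (dualModel I F) (fun _ ↦ 0) f = fun _ ↦ 0 :=
    fun f ↦ funext fun p ↦ map_zero _
  rw [hL, hR]
  refine ⟨hP.isPoissonStructure.isBivectorField, isSmoothVectorField_of_lieDerivFun fun f hf ↦ ?_,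
    fun f g h hf hg hh p ↦ ?_, fun f g hf hg p ↦ ?_⟩
  · rw [hzero]; exact contMDiff_const
  · rw [hP.isPoissonStructure.schouten_self f g h hf hg hh p]
    simp [bivectorWedge]
  · simp [lieDerivBivector, hzero, bivectorBracket, differential_const]

theorem IsLinearPoissonStructure.isJacobiStructure (hP : IsLinearPoissonStructure I P) :
    IsJacobiStructure (dualModel I F) (dualLambda P g) (dualReeb P g) := by
  rcases subsingleton_or_nontrivial F with hF | hF
  · exact isJacobiStructure_of_subsingleton g hP
  · exact hP.isPoissonStructure.isJacobiStructure_add_wedge (contMDiff_kineticEnergy g)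
      (fun f hf ↦ contMDiff_lieDerivFun_liouville hf) (lieDerivFun_liouville_kineticEnergy g)
      (fun f h hf hh p ↦ hP.lieDeriv_liouville hf hh p)

end Homogeneity

end LinearPoisson

/-! ### Inverse function theorem, open subsets and related tensors -/

section SubmanifoldTools

variable {E : Type*} [NormedAddCommGroup E] [NormedSpace ℝ E]
  {H : Type*} [TopologicalSpace H] {I : ModelWithCorners ℝ E H}
  {M : Type*} [TopologicalSpace M] [ChartedSpace H M]
  {E' : Type*} [NormedAddCommGroup E'] [NormedSpace ℝ E']
  {H' : Type*} [TopologicalSpace H'] {J : ModelWithCorners ℝ E' H'}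
  {N : Type*} [TopologicalSpace N] [ChartedSpace H' N]

/-- The inverse function theorem: a left inverse of a smooth map between manifolds of the same
dimension is smooth at the image of every point where the differential is injective. -/
theorem contMDiffAt_leftInverse [FiniteDimensional ℝ E] [FiniteDimensional ℝ E']
    [I.Boundaryless] [J.Boundaryless] [IsManifold I ∞ M] [IsManifold J ∞ N]
    (hdim : finrank ℝ E = finrank ℝ E') {f : M → N} {g : N → M} (hf : ContMDiff I J ∞ f)
    (hg : Function.LeftInverse g f) {x : M} (hinj : Function.Injective (mfderiv I J f x)) :
    ContMDiffAt J I ∞ g (f x) := by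
  have hmd := contMDiff_mdifferentiableAt hf x
  set φ := extChartAt I x with hφ
  set φ' := extChartAt J (f x) with hφ'
  let G : E → E' := φ' ∘ f ∘ φ.symm
  have hG : ContDiffAt ℝ ∞ G (φ x) := by
    have h := (contMDiffAt_iff.1 (hf x)).2
    rwa [I.range_eq_univ, contDiffWithinAt_univ] at h
  have hd : (mfderiv I J f x : E →L[ℝ] E') = fderiv ℝ G (φ x) := by
    rw [hmd.mfderiv, I.range_eq_univ, fderivWithin_univ]
    rfl
  have hinj' : Function.Injective (fderiv ℝ G (φ x) : E →ₗ[ℝ] E') := by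
    rw [← hd]; exact hinj
  let e : E ≃L[ℝ] E' := (LinearEquiv.ofInjectiveOfFinrankEq _ hinj' hdim).toContinuousLinearEquiv
  have he : HasFDerivAt G (e : E →L[ℝ] E') (φ x) := by
    have : (e : E →L[ℝ] E') = fderiv ℝ G (φ x) := by ext; rfl
    rw [this]
    exact (hG.differentiableAt (by simp)).hasFDerivAt
  have hne : (∞ : WithTop ℕ∞) ≠ 0 := by simp
  let l : E' → E := hG.localInverse he hne
  have hGx : G (φ x) = φ' (f x) := by
    simp only [G, Function.comp_apply]
    rw [extChartAt_to_inv]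
  have hl : ContDiffAt ℝ ∞ l (φ' (f x)) := hGx ▸ hG.to_localInverse he hne
  have hlx : l (φ' (f x)) = φ x := hGx ▸ hG.localInverse_apply_image he hne
  have hr : ∀ᶠ z in 𝓝 (φ' (f x)), G (l z) = z :=
    hGx ▸ (hG.hasStrictFDerivAt' he hne).eventually_right_inverse
  -- the smooth local inverse of `f`
  let k : N → M := φ.symm ∘ l ∘ φ'
  have h1 : ContMDiffAt J 𝓘(ℝ, E') ∞ φ' (f x) := contMDiffAt_extChartAt
  have h2 : ContMDiffAt J 𝓘(ℝ, E) ∞ (l ∘ φ') (f x) := hl.contMDiffAt.comp (f x) h1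
  have h3 : ContMDiffAt 𝓘(ℝ, E) I ∞ φ.symm (φ x) :=
    (contMDiffOn_extChartAt_symm x).contMDiffAt (extChartAt_target_mem_nhds x)
  have hk : ContMDiffAt J I ∞ k (f x) :=
    ContMDiffAt.comp_of_eq (g := φ.symm) (f := l ∘ φ') (y := φ x) h3 h2 hlx
  have hkx : k (f x) = x := by
    simp only [k, Function.comp_apply, hlx]
    exact extChartAt_to_inv x
  have hfk : ContinuousAt (f ∘ k) (f x) :=
    (hf.continuous.continuousAt).comp hk.continuousAt
  refine hk.congr_of_eventuallyEq ?_
  have hs' : ∀ᶠ y in 𝓝 (f x), f (k y) ∈ φ'.source :=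
    hfk.eventually (by
      rw [Function.comp_apply, hkx]
      exact extChartAt_source_mem_nhds (f x))
  filter_upwards [h1.continuousAt.eventually hr, hs', extChartAt_source_mem_nhds (I := J) (f x)]
    with y hy hy1 hy2
  have : f (k y) = y := φ'.injOn hy1 hy2 hy
  conv_lhs => rw [← this]
  exact hg _

/-- The inclusion of an open subset has invertible differentials. -/
theorem isInvertible_mfderiv_subtypeVal (U : TopologicalSpace.Opens M) (x : U) :
    (mfderiv I I (Subtype.val : U → M) x).IsInvertible := by
  classical
  let g : M → U := fun p ↦ if h : p ∈ U then ⟨p, h⟩ else x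
  have hgl : g ∘ (Subtype.val : U → M) = id := by
    funext y
    simp [g]
  have hgr : Subtype.val ∘ g =ᶠ[𝓝 (x : M)] id := by
    filter_upwards [U.isOpen.mem_nhds x.2] with y hy
    have : y ∈ U := hy
    simp [g, this]
  have hg : ContMDiffAt I I 1 g x := by
    rw [← contMDiffAt_subtype_iff]
    exact (hgl ▸ contMDiffAt_id : ContMDiffAt I I 1 (g ∘ (Subtype.val : U → M)) x)
  have hv : MDifferentiableAt I I (Subtype.val : U → M) x :=
    (contMDiff_subtype_val (n := 1) x).mdifferentiableAt (by simp)
  have hgd : MDifferentiableAt I I g x := hg.mdifferentiableAt (by simp)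
  have hgx : g x = x := congrFun hgl x
  refine ContinuousLinearMap.IsInvertible.of_inverse
    (g := (mfderiv I I g (x : M) : E →L[ℝ] E)) ?_ ?_
  · have h := mfderiv_comp_of_eq (I := I) (I' := I) (I'' := I) (x := (x : M)) hv hgd hgx
    rw [hgr.mfderiv_eq, mfderiv_id] at h
    have hgx' : (mfderiv I I (Subtype.val : U → M) (g x) : E →L[ℝ] E) =
      (mfderiv I I (Subtype.val : U → M) x : E →L[ℝ] E) := by rw [hgx]
    exact (h.trans (congrArg (fun T : E →L[ℝ] E ↦ T ∘L (mfderiv I I g (x : M) : E →L[ℝ] E))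
      hgx')).symm
  · have h := mfderiv_comp (I := I) (I' := I) (I'' := I) x hgd hv
    rw [hgl, mfderiv_id] at h
    exact h.symm

theorem lieDerivFun_comp_of_vectorRelated {φ : N → M} {V : ∀ y, TangentSpace J y}
    {W : ∀ x, TangentSpace I x} (hVW : VectorRelated I J φ V W) (hφ : ContMDiff J I ∞ φ) {f : M → ℝ}
    (hf : ContMDiff I 𝓘(ℝ, ℝ) ∞ f) :
    lieDerivFun J V (f ∘ φ) = lieDerivFun I W f ∘ φ := by
  funext y
  unfold lieDerivFun
  rw [differential_comp (contMDiff_mdifferentiableAt hf _) (contMDiff_mdifferentiableAt hφ y)]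
  exact congrArg (differential I f (φ y)) (hVW y)

theorem bivectorBracket_comp_of_bivectorRelated {φ : N → M} {P : CoBilinField J N}
    {P' : CoBilinField I M} (hPP : BivectorRelated I J φ P P') (hφ : ContMDiff J I ∞ φ)
    {f h : M → ℝ} (hf : ContMDiff I 𝓘(ℝ, ℝ) ∞ f) (hh : ContMDiff I 𝓘(ℝ, ℝ) ∞ h) :
    bivectorBracket J P (f ∘ φ) (h ∘ φ) = bivectorBracket I P' f h ∘ φ := by
  funext y
  unfold bivectorBracket
  rw [differential_comp (contMDiff_mdifferentiableAt hf _) (contMDiff_mdifferentiableAt hφ y),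
    differential_comp (contMDiff_mdifferentiableAt hh _) (contMDiff_mdifferentiableAt hφ y)]
  exact hPP y _ _

/-- A Jacobi structure restricts along a map `φ` to any pair of `φ`-related tensors, if all
smooth functions extend along `φ`. -/
theorem IsJacobiStructure.of_related [FiniteDimensional ℝ E'] [J.Boundaryless] [T2Space N]
    [IsManifold I ∞ M] [IsManifold J ∞ N] {P : CoBilinField J N} {P' : CoBilinField I M}
    {V : ∀ y, TangentSpace J y} {W : ∀ x, TangentSpace I x} (hJ : IsJacobiStructure I P' W)
    (hWs : ∀ f, ContMDiff I 𝓘(ℝ, ℝ) ∞ f → ContMDiff I 𝓘(ℝ, ℝ) ∞ (lieDerivFun I W f))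
    {φ : N → M} (hφ : ContMDiff J I ∞ φ) (hPP : BivectorRelated I J φ P P')
    (hVW : VectorRelated I J φ V W) (halt : ∀ y, (P y).IsAlt)
    (hext : ∀ f : N → ℝ, ContMDiff J 𝓘(ℝ, ℝ) ∞ f →
      ∃ f' : M → ℝ, ContMDiff I 𝓘(ℝ, ℝ) ∞ f' ∧ f' ∘ φ = f) :
    IsJacobiStructure J P V := by
  have hb := fun {f h} ↦ bivectorBracket_comp_of_bivectorRelated (f := f) (h := h) hPP hφ
  have hv := fun {f} ↦ lieDerivFun_comp_of_vectorRelated (f := f) hVW hφ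
  have hs := hJ.isBivectorField.smooth
  refine ⟨⟨halt, fun f h hf' hh' ↦ ?_⟩, isSmoothVectorField_of_lieDerivFun fun f hf' ↦ ?_,
    fun f h k hf' hh' hk' y ↦ ?_, fun f h hf' hh' y ↦ ?_⟩
  · obtain ⟨f, hf, rfl⟩ := hext f hf'
    obtain ⟨h, hh, rfl⟩ := hext h hh'
    rw [hb hf hh]
    exact (hs f h hf hh).comp hφ
  · obtain ⟨f, hf, rfl⟩ := hext f hf'
    rw [hv hf]
    exact (hWs f hf).comp hφ
  · obtain ⟨f, hf, rfl⟩ := hext f hf'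
    obtain ⟨h, hh, rfl⟩ := hext h hh'
    obtain ⟨k, hk, rfl⟩ := hext k hk'
    have h0 := hJ.schouten_self f h k hf hh hk (φ y)
    rw [schouten_self_eq] at h0 ⊢
    rw [hb hf hh, hb hh hk, hb hk hf, hb (hs f h hf hh) hk, hb (hs h k hh hk) hf,
      hb (hs k f hk hf) hh]
    refine h0.trans ?_
    have e1 : ∀ {f h}, ContMDiff I 𝓘(ℝ, ℝ) ∞ f → ContMDiff I 𝓘(ℝ, ℝ) ∞ h →
        P y (differential J (f ∘ φ) y) (differential J (h ∘ φ) y) =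
          P' (φ y) (differential I f (φ y)) (differential I h (φ y)) :=
      fun hf hh ↦ congrFun (hb hf hh) y
    have e2 : ∀ {f}, ContMDiff I 𝓘(ℝ, ℝ) ∞ f → differential J (f ∘ φ) y (V y) =
          differential I f (φ y) (W (φ y)) := fun hf ↦ congrFun (hv hf) y
    unfold bivectorWedge
    rw [e1 hf hh, e1 hh hk, e1 hk hf, e2 hf, e2 hh, e2 hk]
  · obtain ⟨f, hf, rfl⟩ := hext f hf'
    obtain ⟨h, hh, rfl⟩ := hext h hh'
    have h0 := hJ.lieDeriv f h hf hh (φ y)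
    unfold lieDerivBivector at h0 ⊢
    rw [hb hf hh, hv (hs f h hf hh), hv hf, hv hh, hb (hWs f hf) hh, hb hf (hWs h hh)]
    exact h0

end SubmanifoldTools

/-! ### Restriction of the Jacobi structure to the sphere bundle -/

section SphereBundle

variable {EQ : Type*} [NormedAddCommGroup EQ] [NormedSpace ℝ EQ] [FiniteDimensional ℝ EQ]
  {HQ : Type*} [TopologicalSpace HQ] {I : ModelWithCorners ℝ EQ HQ} [I.Boundaryless]
  {Q : Type*} [TopologicalSpace Q] [T2Space Q] [ChartedSpace HQ Q] [IsManifold I ∞ Q]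
  {F : Type*} [NormedAddCommGroup F] [NormedSpace ℝ F] [FiniteDimensional ℝ F]
  {A : Q → Type*} [TopologicalSpace (TotalSpace F A)]
  [∀ q, AddCommGroup (A q)] [∀ q, Module ℝ (A q)] [∀ q, TopologicalSpace (A q)]
  [∀ q, IsTopologicalAddGroup (A q)] [∀ q, ContinuousSMul ℝ (A q)]
  [FiberBundle F A] [VectorBundle ℝ F A] [ContMDiffVectorBundle ∞ F A I]
  {P : CoBilinField (dualModel I F) (DualTotal F A)} (g : ContMDiffRiemannianMetric I ∞ F A)

theorem kineticVF_pairing (p : DualTotal F A) (β : Cotangent (dualModel I F) p) :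
    β (kineticVF P g p) = -P p (differential (dualModel I F) (kineticEnergy g) p) β :=
  hamiltonianVF_pairing P _ p β

theorem dualLambda_apply (p : DualTotal F A) (α β : Cotangent (dualModel I F) p) :
    dualLambda P g p α β = P p α β +
      (α (liouville I F A p) * β (kineticVF P g p) - α (kineticVF P g p) * β (liouville I F A p)) :=
  rfl

theorem dualLambda_isAlt (hP : ∀ p, (P p).IsAlt) (p : DualTotal F A) :
    (dualLambda P g p).IsAlt := fun α ↦ by
  rw [dualLambda_apply, hP p α]; ring

theorem sphere_snd_ne_zero (s : unitSphereBundle g) : (s : DualTotal F A).2 ≠ 0 := fun h ↦ by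
  have h1 : kineticEnergy g (s : DualTotal F A) = 1 / 2 := s.2
  rw [kineticEnergy_eq_zero g h] at h1
  norm_num at h1

theorem differential_kineticEnergy_liouville (s : unitSphereBundle g) :
    differential (dualModel I F) (kineticEnergy g) s (liouville I F A s) = 1 := by
  have h := lieDerivFun_liouville_kineticEnergy g (s : DualTotal F A)
  have h1 : kineticEnergy g (s : DualTotal F A) = 1 / 2 := s.2
  rw [h1] at h
  exact h.trans (by norm_num)

/-- On the sphere bundle, `dκ` is in the kernel of `P + Δ ∧ X_κ`. -/
theorem dualLambda_differential_kineticEnergy (hP : ∀ p, (P p).IsAlt) (s : unitSphereBundle g)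
    (β : Cotangent (dualModel I F) (s : DualTotal F A)) :
    dualLambda P g s (differential (dualModel I F) (kineticEnergy g) s) β = 0 := by
  rw [dualLambda_apply, differential_kineticEnergy_liouville, kineticVF_pairing, kineticVF_pairing,
    hP _ _]
  ring

/-- Radial projection of `A*` without its zero section onto the unit sphere bundle. The zero section
itself is fixed. -/
def sphereProj (p : DualTotal F A) : DualTotal F A :=
  fiberScale (√(2 * kineticEnergy g p))⁻¹ p

theorem sphereProj_mem {p : DualTotal F A} (hp : p.2 ≠ 0) : sphereProj g p ∈ unitSphereBundle g := by
  have h := kineticEnergy_pos g hp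
  change kineticEnergy g (fiberScale _ p) = 1 / 2
  rw [kineticEnergy_fiberScale, inv_pow, Real.sq_sqrt (by positivity)]
  field_simp

theorem sphereProj_fiberScale {c : ℝ} (hc : 0 < c) (p : DualTotal F A) :
    sphereProj g (fiberScale c p) = sphereProj g p := by
  unfold sphereProj
  rw [kineticEnergy_fiberScale, fiberScale_fiberScale]
  congr 1
  rw [show 2 * (c ^ 2 * kineticEnergy g p) = c ^ 2 * (2 * kineticEnergy g p) by ring,
    Real.sqrt_mul (by positivity), Real.sqrt_sq hc.le, mul_inv, mul_comm, ← mul_assoc,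
    mul_inv_cancel₀ hc.ne', one_mul]

theorem sphereProj_of_mem {p : DualTotal F A} (hp : p ∈ unitSphereBundle g) :
    sphereProj g p = p := by
  have h : kineticEnergy g p = 1 / 2 := hp
  unfold sphereProj
  rw [h, show (2 : ℝ) * (1 / 2) = 1 by norm_num, Real.sqrt_one, inv_one, fiberScale_one]

theorem contMDiffAt_sphereProj {p : DualTotal F A} (hp : p.2 ≠ 0) :
    ContMDiffAt (dualModel I F) (dualModel I F) ∞ (sphereProj g) p := by
  have h := kineticEnergy_pos g hp
  have h1 : ContDiffAt ℝ ∞ (fun x : ℝ ↦ (√(2 * x))⁻¹) (kineticEnergy g p) :=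
    ((contDiffAt_const.mul contDiffAt_id).sqrt (by simpa using h.ne')).inv
      (Real.sqrt_ne_zero'.2 (by positivity))
  have h2 : ContMDiffAt (dualModel I F) 𝓘(ℝ, ℝ) ∞
      (fun p : DualTotal F A ↦ (√(2 * kineticEnergy g p))⁻¹) p :=
    h1.contMDiffAt.comp p (contMDiff_kineticEnergy g p)
  exact (contMDiff_fiberScale.contMDiffAt).comp p (h2.prodMk contMDiffAt_id)

theorem finrank_pos_of_sphere (s : unitSphereBundle g) : 0 < finrank ℝ F := by
  by_contra h
  have : Subsingleton F := (finrank_zero_iff (R := ℝ) (M := F)).1 (by omega)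
  exact sphere_snd_ne_zero g s ((dualCoord_eq_zero_iff
    (FiberBundle.mem_baseSet_trivializationAt' (F := F) (E := A) (s : DualTotal F A).1)).1
      (Subsingleton.elim _ _))

theorem finrank_dual_model : finrank ℝ (EQ × (F →L[ℝ] ℝ)) = finrank ℝ EQ + finrank ℝ F := by
  rw [finrank_prod, ← (LinearMap.toContinuousLinearMap : (F →ₗ[ℝ] ℝ) ≃ₗ[ℝ] F →L[ℝ] ℝ).finrank_eq,
    Subspace.dual_finrank_eq]

section Structure

variable [ChartedSpace (ModelProd HQ (EuclideanSpace ℝ (Fin (finrank ℝ F - 1))))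
    (unitSphereBundle g)]
  [IsManifold (sphereModel I F) ∞ (unitSphereBundle g)]

variable {g}

theorem covectorPullback_differential_kineticEnergy
    (hι : IsSmoothEmb (dualModel I F) (sphereModel I F) (sphereIncl g)) (s : unitSphereBundle g) :
    covectorPullback (dualModel I F) (sphereModel I F) (sphereIncl g) s
      (differential (dualModel I F) (kineticEnergy g) s) = 0 := by
  rw [← differential_comp (contMDiff_mdifferentiableAt (contMDiff_kineticEnergy g) _)
    (contMDiff_mdifferentiableAt hι.contMDiff s)]
  have : kineticEnergy g ∘ sphereIncl g = fun _ ↦ 1 / 2 := funext fun s ↦ s.2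
  rw [this, differential_const]

/-- The tangent space of the sphere bundle is the kernel of `dκ`. -/
theorem exists_mfderiv_sphereIncl_eq
    (hι : IsSmoothEmb (dualModel I F) (sphereModel I F) (sphereIncl g)) (s : unitSphereBundle g)
    {v : TangentSpace (dualModel I F) (s : DualTotal F A)}
    (hv : differential (dualModel I F) (kineticEnergy g) s v = 0) :
    ∃ w : TangentSpace (sphereModel I F) s,
      mfderiv (sphereModel I F) (dualModel I F) (sphereIncl g) s w = v := by
  let T : EQ × EuclideanSpace ℝ (Fin (finrank ℝ F - 1)) →ₗ[ℝ] EQ × (F →L[ℝ] ℝ) :=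
    (mfderiv (sphereModel I F) (dualModel I F) (sphereIncl g) s :
      EQ × EuclideanSpace ℝ (Fin (finrank ℝ F - 1)) →L[ℝ] EQ × (F →L[ℝ] ℝ)).toLinearMap
  let d : EQ × (F →L[ℝ] ℝ) →ₗ[ℝ] ℝ := differential (dualModel I F) (kineticEnergy g) s
  have hT : Function.Injective T := hι.injective_mfderiv s
  have hle : LinearMap.range T ≤ LinearMap.ker d := by
    rintro _ ⟨w, rfl⟩
    exact LinearMap.congr_fun (covectorPullback_differential_kineticEnergy hι s) w
  have hd : Function.Surjective d := by
    intro c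
    let v : EQ × (F →L[ℝ] ℝ) := liouville I F A (s : DualTotal F A)
    have h1 : d v = 1 := differential_kineticEnergy_liouville g s
    exact ⟨c • v, (map_smul d c v).trans (by rw [h1, smul_eq_mul, mul_one])⟩
  have h1 := LinearMap.finrank_range_of_inj hT
  have h2 := LinearMap.finrank_range_add_finrank_ker d
  rw [LinearMap.range_eq_top.2 hd, finrank_top, finrank_self, finrank_dual_model] at h2
  rw [finrank_prod, finrank_euclideanSpace_fin] at h1
  -- the rank is positive, so that the dimension `rank A - 1` of the spheres is not truncated
  have h3 := finrank_pos_of_sphere g s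
  have heq := Submodule.eq_of_le_of_finrank_eq hle (by omega)
  let v' : EQ × (F →L[ℝ] ℝ) := v
  have hv' : d v' = 0 := hv
  rw [← LinearMap.mem_ker, ← heq] at hv'
  obtain ⟨w, hw⟩ := hv'
  exact ⟨w, hw⟩

/-- A covector which vanishes on the sphere bundle is a multiple of `dκ`. -/
theorem eq_smul_of_covectorPullback_eq_zero
    (hι : IsSmoothEmb (dualModel I F) (sphereModel I F) (sphereIncl g)) (s : unitSphereBundle g)
    {α : Cotangent (dualModel I F) (s : DualTotal F A)}
    (hα : covectorPullback (dualModel I F) (sphereModel I F) (sphereIncl g) s α = 0) :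
    ∃ c : ℝ, α = c • differential (dualModel I F) (kineticEnergy g) (s : DualTotal F A) := by
  let d : EQ × (F →L[ℝ] ℝ) →ₗ[ℝ] ℝ := differential (dualModel I F) (kineticEnergy g) s
  let D : EQ × (F →L[ℝ] ℝ) := liouville I F A (s : DualTotal F A)
  let a : EQ × (F →L[ℝ] ℝ) →ₗ[ℝ] ℝ := α
  have hD : d D = 1 := differential_kineticEnergy_liouville g s
  refine ⟨a D, LinearMap.ext fun v ↦ ?_⟩
  let v' : EQ × (F →L[ℝ] ℝ) := v
  have h1 : d (v' - d v' • D) = 0 := by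
    rw [map_sub, map_smul, hD, smul_eq_mul, mul_one, sub_self]
  obtain ⟨w, hw⟩ := exists_mfderiv_sphereIncl_eq hι s h1
  have h2 : a (v' - d v' • D) = 0 := (congrArg a hw).symm.trans (LinearMap.congr_fun hα w)
  rw [map_sub, map_smul, sub_eq_zero, smul_eq_mul, mul_comm] at h2
  exact h2

/-- On the sphere bundle, `P + Δ ∧ X_κ` depends only on the restrictions of its arguments to the
sphere bundle. -/
theorem dualLambda_eq_of_covectorPullback_eq (hP : ∀ p, (P p).IsAlt)
    (hι : IsSmoothEmb (dualModel I F) (sphereModel I F) (sphereIncl g)) (s : unitSphereBundle g)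
    {α α' β β' : Cotangent (dualModel I F) (s : DualTotal F A)}
    (hα : covectorPullback (dualModel I F) (sphereModel I F) (sphereIncl g) s α =
      covectorPullback (dualModel I F) (sphereModel I F) (sphereIncl g) s α')
    (hβ : covectorPullback (dualModel I F) (sphereModel I F) (sphereIncl g) s β =
      covectorPullback (dualModel I F) (sphereModel I F) (sphereIncl g) s β') :
    dualLambda P g s α β = dualLambda P g s α' β' := by
  have key : ∀ {α α' : Cotangent (dualModel I F) (s : DualTotal F A)},
      covectorPullback (dualModel I F) (sphereModel I F) (sphereIncl g) s α =
      covectorPullback (dualModel I F) (sphereModel I F) (sphereIncl g) s α' →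
      ∀ β, dualLambda P g s α β = dualLambda P g s α' β := by
    intro α α' h β
    have h0 : covectorPullback (dualModel I F) (sphereModel I F) (sphereIncl g) s (α - α') = 0 := by
      ext w
      have := LinearMap.congr_fun h w
      exact sub_eq_zero.2 this
    obtain ⟨c, h1⟩ := eq_smul_of_covectorPullback_eq_zero hι s h0
    rw [← sub_eq_zero, ← LinearMap.sub_apply, ← map_sub, h1, map_smul, LinearMap.smul_apply,
      dualLambda_differential_kineticEnergy g hP, smul_zero]
  rw [key hα, ← neg_inj, LinearMap.IsAlt.neg (dualLambda_isAlt g hP _),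
    LinearMap.IsAlt.neg (dualLambda_isAlt g hP _), key hβ]

theorem exists_covectorPullback_rightInverse
    (hι : IsSmoothEmb (dualModel I F) (sphereModel I F) (sphereIncl g)) (s : unitSphereBundle g) :
    ∃ σ : Cotangent (sphereModel I F) s →ₗ[ℝ] Cotangent (dualModel I F) (s : DualTotal F A),
      ∀ ξ, covectorPullback (dualModel I F) (sphereModel I F) (sphereIncl g) s (σ ξ) = ξ := by
  have hsurj := LinearMap.dualMap_surjective_of_injective
    (f := (mfderiv (sphereModel I F) (dualModel I F) (sphereIncl g) s).toLinearMap)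
    (hι.injective_mfderiv s)
  obtain ⟨σ, hσ⟩ := LinearMap.exists_rightInverse_of_surjective _ (LinearMap.range_eq_top.2 hsurj)
  exact ⟨σ, fun ξ ↦ LinearMap.congr_fun hσ ξ⟩

/-- The `2`-vector field `P + Δ ∧ X_κ` restricts to the sphere bundle. -/
theorem exists_bivectorRelated (hP : ∀ p, (P p).IsAlt)
    (hι : IsSmoothEmb (dualModel I F) (sphereModel I F) (sphereIncl g)) :
    ∃ ΛS : CoBilinField (sphereModel I F) (unitSphereBundle g),
      (∀ s, (ΛS s).IsAlt) ∧
      BivectorRelated (dualModel I F) (sphereModel I F) (sphereIncl g) ΛS (dualLambda P g) := by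
  choose σ hσ using fun s ↦ exists_covectorPullback_rightInverse hι s
  refine ⟨fun s ↦ (dualLambda P g s).compl₁₂ (σ s) (σ s),
    fun s ξ ↦ dualLambda_isAlt g hP _ (σ s ξ), fun s α β ↦ ?_⟩
  exact dualLambda_eq_of_covectorPullback_eq hP hι s (hσ s _) (hσ s _)

/-- The vector field `-X_κ` is tangent to the sphere bundle, since `κ` is a first integral. -/
theorem exists_vectorRelated (hP : ∀ p, (P p).IsAlt)
    (hι : IsSmoothEmb (dualModel I F) (sphereModel I F) (sphereIncl g)) :
    ∃ RS : ∀ s : unitSphereBundle g, TangentSpace (sphereModel I F) s,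
      VectorRelated (dualModel I F) (sphereModel I F) (sphereIncl g) RS (dualReeb P g) := by
  have h : ∀ s : unitSphereBundle g, ∃ w : TangentSpace (sphereModel I F) s,
      mfderiv (sphereModel I F) (dualModel I F) (sphereIncl g) s w = dualReeb P g s := by
    intro s
    refine exists_mfderiv_sphereIncl_eq hι s ?_
    unfold dualReeb
    rw [map_neg, kineticVF_pairing, hP, neg_zero, neg_zero]
  choose RS hRS using h
  exact ⟨RS, hRS⟩

end Structure

end SphereBundle

/-! ### Polar coordinates on the dual bundle -/

section PolarCoordinates

variable {EQ : Type*} [NormedAddCommGroup EQ] [NormedSpace ℝ EQ] [FiniteDimensional ℝ EQ]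
  {HQ : Type*} [TopologicalSpace HQ] {I : ModelWithCorners ℝ EQ HQ} [I.Boundaryless]
  {Q : Type*} [TopologicalSpace Q] [T2Space Q] [ChartedSpace HQ Q] [IsManifold I ∞ Q]
  {F : Type*} [NormedAddCommGroup F] [NormedSpace ℝ F] [FiniteDimensional ℝ F]
  {A : Q → Type*} [TopologicalSpace (TotalSpace F A)]
  [∀ q, AddCommGroup (A q)] [∀ q, Module ℝ (A q)] [∀ q, TopologicalSpace (A q)]
  [∀ q, IsTopologicalAddGroup (A q)] [∀ q, ContinuousSMul ℝ (A q)]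
  [FiberBundle F A] [VectorBundle ℝ F A] [ContMDiffVectorBundle ∞ F A I]
  {P : CoBilinField (dualModel I F) (DualTotal F A)} (g : ContMDiffRiemannianMetric I ∞ F A)

/-- The map `(β, t) ↦ e^t β` from `S_g(A*) × ℝ` to `A*`. -/
def polarMap (z : unitSphereBundle g × ℝ) : DualTotal F A :=
  fiberScale (Real.exp z.2) (z.1 : DualTotal F A)

theorem polarMap_snd_ne_zero (z : unitSphereBundle g × ℝ) : (polarMap g z).2 ≠ 0 :=
  smul_ne_zero (Real.exp_ne_zero _) (sphere_snd_ne_zero g z.1)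

theorem sphereProj_polarMap (z : unitSphereBundle g × ℝ) :
    sphereProj g (polarMap g z) = sphereIncl g z.1 := by
  rw [polarMap, sphereProj_fiberScale g (Real.exp_pos _), sphereProj_of_mem g z.1.2]

theorem kineticEnergy_polarMap (z : unitSphereBundle g × ℝ) :
    kineticEnergy g (polarMap g z) = Real.exp (2 * z.2) / 2 := by
  have h : kineticEnergy g (z.1 : DualTotal F A) = 1 / 2 := z.1.2
  rw [polarMap, kineticEnergy_fiberScale, h, ← Real.exp_nat_mul]
  push_cast
  ring

/-- Polar coordinates on `A*` without its zero section. -/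
def polarEquiv : unitSphereBundle g × ℝ ≃ zeroSectionCompl F A where
  toFun z := ⟨polarMap g z, polarMap_snd_ne_zero g z⟩
  invFun p := (⟨sphereProj g p, sphereProj_mem g p.2⟩, Real.log √(2 * kineticEnergy g p))
  left_inv z := by
    refine Prod.ext (Subtype.ext (sphereProj_polarMap g z)) ?_
    change Real.log √(2 * kineticEnergy g (polarMap g z)) = z.2
    rw [kineticEnergy_polarMap, mul_div_cancel₀ _ two_ne_zero, Real.log_sqrt (Real.exp_pos _).le,
      Real.log_exp, mul_div_cancel_left₀ _ two_ne_zero]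
  right_inv p := by
    have h := kineticEnergy_pos g p.2
    have h' : 0 < √(2 * kineticEnergy g (p : DualTotal F A)) := Real.sqrt_pos.2 (by positivity)
    refine Subtype.ext ?_
    change fiberScale (Real.exp (Real.log _)) (fiberScale _ _) = _
    rw [Real.exp_log h', fiberScale_fiberScale, mul_inv_cancel₀ h'.ne', fiberScale_one]

section Structure

variable [ChartedSpace (ModelProd HQ (EuclideanSpace ℝ (Fin (finrank ℝ F - 1))))
    (unitSphereBundle g)]
  [IsManifold (sphereModel I F) ∞ (unitSphereBundle g)]

variable {g}

theorem contMDiff_polarMap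
    (hι : IsSmoothEmb (dualModel I F) (sphereModel I F) (sphereIncl g)) :
    ContMDiff ((sphereModel I F).prod 𝓘(ℝ, ℝ)) (dualModel I F) ∞ (polarMap g) :=
  contMDiff_fiberScale.comp
    ((Real.contDiff_exp.contMDiff.comp contMDiff_snd).prodMk (hι.contMDiff.comp contMDiff_fst))

theorem injective_mfderiv_polarMap
    (hι : IsSmoothEmb (dualModel I F) (sphereModel I F) (sphereIncl g))
    (z : unitSphereBundle g × ℝ) :
    Function.Injective
      (mfderiv ((sphereModel I F).prod 𝓘(ℝ, ℝ)) (dualModel I F) (polarMap g) z) := by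
  have hm := contMDiff_mdifferentiableAt (contMDiff_polarMap hι) z
  have hfst : MDifferentiableAt ((sphereModel I F).prod 𝓘(ℝ, ℝ)) (sphereModel I F)
    (Prod.fst : unitSphereBundle g × ℝ → _) z := mdifferentiableAt_fst
  let T : (EQ × EuclideanSpace ℝ (Fin (finrank ℝ F - 1))) × ℝ →L[ℝ] EQ × (F →L[ℝ] ℝ) :=
    mfderiv ((sphereModel I F).prod 𝓘(ℝ, ℝ)) (dualModel I F) (polarMap g) z
  let T' : EQ × EuclideanSpace ℝ (Fin (finrank ℝ F - 1)) →L[ℝ] EQ × (F →L[ℝ] ℝ) :=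
    mfderiv (sphereModel I F) (dualModel I F) (sphereIncl g) z.1
  let S : EQ × (F →L[ℝ] ℝ) →L[ℝ] EQ × (F →L[ℝ] ℝ) :=
    mfderiv (dualModel I F) (dualModel I F) (sphereProj g) (polarMap g z)
  let K : EQ × (F →L[ℝ] ℝ) →L[ℝ] ℝ :=
    mfderiv (dualModel I F) 𝓘(ℝ, ℝ) (kineticEnergy g) (polarMap g z)
  have hT' : Function.Injective T' := hι.injective_mfderiv z.1
  suffices h : Function.Injective T from h
  refine (injective_iff_map_eq_zero T).2 fun w hw ↦ ?_
  -- the first component of a vector in the kernel is detected by the radial projection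
  have h1 := mfderiv_comp_apply z ((contMDiffAt_sphereProj g
      (polarMap_snd_ne_zero g z)).mdifferentiableAt (by simp)) hm w
  have h2 : sphereProj g ∘ polarMap g = sphereIncl g ∘ Prod.fst := funext (sphereProj_polarMap g)
  have e1 := mfderiv_comp z (contMDiff_mdifferentiableAt hι.contMDiff z.1) hfst
  rw [mfderiv_fst] at e1
  rw [h2] at h1
  have h1' : T' w.1 = 0 := (DFunLike.congr_fun e1 w).symm.trans <| h1.trans
    ((congrArg S hw).trans (map_zero S))
  have h3 : w.1 = 0 := (injective_iff_map_eq_zero T').1 hT' _ h1'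
  -- and the second one by the kinetic energy
  have h4 := mfderiv_comp_apply z
    (contMDiff_mdifferentiableAt (contMDiff_kineticEnergy g) (polarMap g z)) hm w
  have h5 : kineticEnergy g ∘ polarMap g = (fun t : ℝ ↦ Real.exp (2 * t) / 2) ∘ Prod.snd :=
    funext (kineticEnergy_polarMap g)
  have h6 : HasDerivAt (fun t : ℝ ↦ Real.exp (2 * t) / 2) (Real.exp (2 * z.2)) z.2 := by
    have := (((hasDerivAt_id z.2).const_mul 2).exp).div_const 2
    simpa using this
  have hsnd : MDifferentiableAt ((sphereModel I F).prod 𝓘(ℝ, ℝ)) 𝓘(ℝ, ℝ)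
    (Prod.snd : unitSphereBundle g × ℝ → _) z := mdifferentiableAt_snd
  have e4 := mfderiv_comp z h6.differentiableAt.mdifferentiableAt hsnd
  rw [mfderiv_snd, mfderiv_eq_fderiv, h6.hasFDerivAt.fderiv] at e4
  rw [h5] at h4
  have h7 : w.2 * Real.exp (2 * z.2) = 0 :=
    (DFunLike.congr_fun e4 w).symm.trans <| h4.trans
      ((congrArg K hw).trans (map_zero K))
  have h8 : w.2 = 0 := (mul_eq_zero.1 h7).resolve_right (Real.exp_ne_zero _)
  exact Prod.ext h3 h8

theorem contMDiff_polarEquiv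
    (hι : IsSmoothEmb (dualModel I F) (sphereModel I F) (sphereIncl g)) :
    ContMDiff ((sphereModel I F).prod 𝓘(ℝ, ℝ)) (dualModel I F) ∞ (polarEquiv g) :=
  (ContMDiff.subtypeVal_comp_iff _ _).1 (contMDiff_polarMap hι)

theorem injective_mfderiv_polarEquiv
    (hι : IsSmoothEmb (dualModel I F) (sphereModel I F) (sphereIncl g))
    (z : unitSphereBundle g × ℝ) :
    Function.Injective
      (mfderiv ((sphereModel I F).prod 𝓘(ℝ, ℝ)) (dualModel I F) (polarEquiv g) z) := by
  have h := mfderiv_comp (I := (sphereModel I F).prod 𝓘(ℝ, ℝ)) (I' := dualModel I F)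
    (I'' := dualModel I F) (f := polarEquiv g) (g := Subtype.val) z
    (contMDiff_mdifferentiableAt contMDiff_subtype_val _)
    (contMDiff_mdifferentiableAt (contMDiff_polarEquiv hι) z)
  have h2 := injective_mfderiv_polarMap hι z
  refine Function.Injective.of_comp (f := mfderiv (dualModel I F) (dualModel I F)
    (Subtype.val : zeroSectionCompl F A → DualTotal F A) (polarEquiv g z)) ?_
  change Function.Injective (mfderiv ((sphereModel I F).prod 𝓘(ℝ, ℝ)) (dualModel I F)
    (Subtype.val ∘ polarEquiv g) z) at h2
  rw [h] at h2
  exact h2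

theorem contMDiff_polarEquiv_symm
    (hι : IsSmoothEmb (dualModel I F) (sphereModel I F) (sphereIncl g)) :
    ContMDiff (dualModel I F) ((sphereModel I F).prod 𝓘(ℝ, ℝ)) ∞ (polarEquiv g).symm := by
  intro p
  obtain ⟨z, rfl⟩ := (polarEquiv g).surjective p
  refine contMDiffAt_leftInverse ?_ (contMDiff_polarEquiv hι) (polarEquiv g).left_inv
    (injective_mfderiv_polarEquiv hι z)
  have := finrank_pos_of_sphere g z.1
  rw [finrank_dual_model, finrank_prod, finrank_prod, finrank_euclideanSpace_fin, finrank_self]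
  omega

/-- The diffeomorphism `(β, t) ↦ e^t β` from `S_g(A*) × ℝ` onto `A*` without its zero section. -/
def polarDiffeomorph
    (hι : IsSmoothEmb (dualModel I F) (sphereModel I F) (sphereIncl g)) :
    Diffeomorph ((sphereModel I F).prod 𝓘(ℝ, ℝ)) (dualModel I F)
      (unitSphereBundle g × ℝ) (zeroSectionCompl F A) ∞ where
  toEquiv := polarEquiv g
  contMDiff_toFun := contMDiff_polarEquiv hι
  contMDiff_invFun := contMDiff_polarEquiv_symm hι

/-- Smooth functions on the sphere bundle extend to `A*`: extend them radially, and cut off near the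
zero section. -/
theorem exists_contMDiff_extension
    (hι : IsSmoothEmb (dualModel I F) (sphereModel I F) (sphereIncl g))
    {f : unitSphereBundle g → ℝ} (hf : ContMDiff (sphereModel I F) 𝓘(ℝ, ℝ) ∞ f) :
    ∃ f' : DualTotal F A → ℝ, ContMDiff (dualModel I F) 𝓘(ℝ, ℝ) ∞ f' ∧ f' ∘ sphereIncl g = f := by
  classical
  let r : DualTotal F A → ℝ := fun p ↦
    if h : p.2 ≠ 0 then f ((polarEquiv g).symm ⟨p, h⟩).1 else 0
  -- the cutoff is `0` where `κ < 1 / 4`, and `1` on the sphere bundle, where `κ = 1 / 2`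
  let χ : DualTotal F A → ℝ := fun p ↦ Real.smoothTransition (4 * kineticEnergy g p - 1)
  have hχ : ContMDiff (dualModel I F) 𝓘(ℝ, ℝ) ∞ χ :=
    (Real.smoothTransition.contDiff.comp
      ((contDiff_const.mul contDiff_id).sub contDiff_const)).contMDiff.comp
      (contMDiff_kineticEnergy g)
  refine ⟨fun p ↦ χ p * r p, fun p ↦ ?_, funext fun s ↦ ?_⟩
  · by_cases hp : p.2 = 0
    · have h0 : ∀ᶠ p' in 𝓝 p, kineticEnergy g p' < 1 / 4 := by
        refine (contMDiff_kineticEnergy g).continuous.continuousAt.eventually_lt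
          continuousAt_const ?_
        rw [kineticEnergy_eq_zero g hp]
        norm_num
      refine (contMDiffAt_const (c := (0 : ℝ))).congr_of_eventuallyEq ?_
      filter_upwards [h0] with p' hp'
      rw [show χ p' = 0 from Real.smoothTransition.zero_of_nonpos (by linarith), zero_mul]
    · refine hχ.contMDiffAt.mul ?_
      have h1 : ContMDiffAt (dualModel I F) 𝓘(ℝ, ℝ) ∞
          (fun x : zeroSectionCompl F A ↦ r x) ⟨p, hp⟩ := by
        have h2 : (fun x : zeroSectionCompl F A ↦ r x) = fun x ↦ f ((polarEquiv g).symm x).1 :=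
          funext fun x ↦ dif_pos x.2
        rw [h2]
        exact (hf.comp (contMDiff_fst.comp (contMDiff_polarEquiv_symm hι))).contMDiffAt
      exact contMDiffAt_subtype_iff.1 h1
  · have h1 : kineticEnergy g (s : DualTotal F A) = 1 / 2 := s.2
    have h2 : ((polarEquiv g).symm ⟨(s : DualTotal F A), sphere_snd_ne_zero g s⟩).1 = s :=
      Subtype.ext (sphereProj_of_mem g s.2)
    change χ s * r s = f s
    rw [show χ s = 1 from Real.smoothTransition.one_of_one_le (by rw [h1]; norm_num), one_mul,
      show r s = _ from dif_pos (sphere_snd_ne_zero g s), h2]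

/-- A pair of tensors on the sphere bundle that is related to `(P + Δ ∧ X_κ, -X_κ)` is a Jacobi
structure. -/
theorem IsLinearPoissonStructure.isJacobiStructure_sphere (hP : IsLinearPoissonStructure I P)
    (hι : IsSmoothEmb (dualModel I F) (sphereModel I F) (sphereIncl g))
    {ΛS : CoBilinField (sphereModel I F) (unitSphereBundle g)}
    {RS : ∀ s : unitSphereBundle g, TangentSpace (sphereModel I F) s} (halt : ∀ s, (ΛS s).IsAlt)
    (hΛ : BivectorRelated (dualModel I F) (sphereModel I F) (sphereIncl g) ΛS (dualLambda P g))
    (hR : VectorRelated (dualModel I F) (sphereModel I F) (sphereIncl g) RS (dualReeb P g)) :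
    IsJacobiStructure (sphereModel I F) ΛS RS := by
  refine (hP.isJacobiStructure g).of_related (fun f hf ↦ ?_) hι.contMDiff hΛ hR halt
    (fun f hf ↦ exists_contMDiff_extension hι hf)
  have : lieDerivFun (dualModel I F) (dualReeb P g) f =
      bivectorBracket (dualModel I F) P (kineticEnergy g) f := by
    funext p
    unfold lieDerivFun dualReeb
    rw [map_neg, kineticVF_pairing, neg_neg]
    rfl
  rw [this]
  exact hP.isPoissonStructure.isBivectorField.smooth _ _ (contMDiff_kineticEnergy g) hf

theorem jacobiBracket_sphere
    (hι : IsSmoothEmb (dualModel I F) (sphereModel I F) (sphereIncl g))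
    {ΛS : CoBilinField (sphereModel I F) (unitSphereBundle g)}
    {RS : ∀ s : unitSphereBundle g, TangentSpace (sphereModel I F) s}
    (hΛ : BivectorRelated (dualModel I F) (sphereModel I F) (sphereIncl g) ΛS (dualLambda P g))
    (hR : VectorRelated (dualModel I F) (sphereModel I F) (sphereIncl g) RS (dualReeb P g))
    {G₁ G₂ : DualTotal F A → ℝ} (h₁ : ContMDiff (dualModel I F) 𝓘(ℝ, ℝ) ∞ G₁)
    (h₂ : ContMDiff (dualModel I F) 𝓘(ℝ, ℝ) ∞ G₂) (s : unitSphereBundle g) :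
    jacobiBracket (sphereModel I F) ΛS RS (G₁ ∘ sphereIncl g) (G₂ ∘ sphereIncl g) s =
      bivectorBracket (dualModel I F) P G₁ G₂ s
      - bivectorBracket (dualModel I F) P (kineticEnergy g) G₁ s
        * (G₂ s - lieDerivFun (dualModel I F) (liouville I F A) G₂ s)
      + bivectorBracket (dualModel I F) P (kineticEnergy g) G₂ s
        * (G₁ s - lieDerivFun (dualModel I F) (liouville I F A) G₁ s) := by
  unfold jacobiBracket
  rw [bivectorBracket_comp_of_bivectorRelated hΛ hι.contMDiff h₁ h₂,
    lieDerivFun_comp_of_vectorRelated hR hι.contMDiff h₁,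
    lieDerivFun_comp_of_vectorRelated hR hι.contMDiff h₂]
  simp only [Function.comp_apply]
  unfold bivectorBracket lieDerivFun dualReeb
  rw [dualLambda_apply, map_neg, map_neg, kineticVF_pairing, kineticVF_pairing]
  ring

end Structure

end PolarCoordinates

/-! ### The Poissonization of the sphere bundle -/

section Poissonization

variable {EQ : Type*} [NormedAddCommGroup EQ] [NormedSpace ℝ EQ] [FiniteDimensional ℝ EQ]
  {HQ : Type*} [TopologicalSpace HQ] {I : ModelWithCorners ℝ EQ HQ} [I.Boundaryless]
  {Q : Type*} [TopologicalSpace Q] [T2Space Q] [ChartedSpace HQ Q] [IsManifold I ∞ Q]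
  {F : Type*} [NormedAddCommGroup F] [NormedSpace ℝ F] [FiniteDimensional ℝ F]
  {A : Q → Type*} [TopologicalSpace (TotalSpace F A)]
  [∀ q, AddCommGroup (A q)] [∀ q, Module ℝ (A q)] [∀ q, TopologicalSpace (A q)]
  [∀ q, IsTopologicalAddGroup (A q)] [∀ q, ContinuousSMul ℝ (A q)]
  [FiberBundle F A] [VectorBundle ℝ F A] [ContMDiffVectorBundle ∞ F A I]
  {P : CoBilinField (dualModel I F) (DualTotal F A)} {g : ContMDiffRiemannianMetric I ∞ F A}
  [ChartedSpace (ModelProd HQ (EuclideanSpace ℝ (Fin (finrank ℝ F - 1)))) (unitSphereBundle g)]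
  [IsManifold (sphereModel I F) ∞ (unitSphereBundle g)]

/-- A covector at a point of the open subset `A* ∖ 0` of `A*`, as a covector of `A*`, by the transport
that defines `restrictOpens`. -/
def covectorOfOpens {p : zeroSectionCompl F A} (α : Cotangent (dualModel I F) p) :
    Cotangent (dualModel I F) (p : DualTotal F A) :=
  α ∘ₗ (mfderiv (dualModel I F) (dualModel I F)
    (Subtype.val : zeroSectionCompl F A → DualTotal F A) p).inverse.toLinearMap

theorem covectorPullback_polarEquiv
    (hι : IsSmoothEmb (dualModel I F) (sphereModel I F) (sphereIncl g))
    (z : unitSphereBundle g × ℝ) (α : Cotangent (dualModel I F) (polarEquiv g z)) :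
    covectorPullback (dualModel I F) ((sphereModel I F).prod 𝓘(ℝ, ℝ)) (polarEquiv g) z α =
      covectorPullback (dualModel I F) ((sphereModel I F).prod 𝓘(ℝ, ℝ)) (polarMap g) z
        (covectorOfOpens α) := by
  ext w
  have h := mfderiv_comp (I := (sphereModel I F).prod 𝓘(ℝ, ℝ)) (I' := dualModel I F)
    (I'' := dualModel I F) (f := polarEquiv g) (g := Subtype.val) z
    (contMDiff_mdifferentiableAt contMDiff_subtype_val _)
    (contMDiff_mdifferentiableAt (contMDiff_polarEquiv hι) z)
  have hi := isInvertible_mfderiv_subtypeVal (I := dualModel I F) (zeroSectionCompl F A)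
    (polarEquiv g z)
  refine (congrArg α ?_ : α (mfderiv ((sphereModel I F).prod 𝓘(ℝ, ℝ)) (dualModel I F)
    (polarEquiv g) z w) = _)
  refine (hi.inverse_apply_self _).symm.trans ?_
  exact congrArg (ContinuousLinearMap.inverse _) (DFunLike.congr_fun h w).symm

theorem covectorPullback_polarMap_left
    (hι : IsSmoothEmb (dualModel I F) (sphereModel I F) (sphereIncl g))
    (z : unitSphereBundle g × ℝ) (α : Cotangent (dualModel I F) (polarMap g z)) :
    covectorPullback ((sphereModel I F).prod 𝓘(ℝ, ℝ)) (sphereModel I F)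
      (fun y : unitSphereBundle g ↦ (y, z.2)) z.1
      (covectorPullback (dualModel I F) ((sphereModel I F).prod 𝓘(ℝ, ℝ)) (polarMap g) z α) =
    covectorPullback (dualModel I F) (sphereModel I F) (sphereIncl g) z.1
      (covectorPullback (dualModel I F) (dualModel I F) (fiberScale (Real.exp z.2))
        (z.1 : DualTotal F A) α) := by
  ext w
  have hj : MDifferentiableAt (sphereModel I F) ((sphereModel I F).prod 𝓘(ℝ, ℝ))
      (fun y : unitSphereBundle g ↦ (y, z.2)) z.1 :=
    mdifferentiableAt_id.prodMk mdifferentiableAt_const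
  have h1 := mfderiv_comp (f := fun y : unitSphereBundle g ↦ (y, z.2)) (g := polarMap g) z.1
    (contMDiff_mdifferentiableAt (contMDiff_polarMap hι) _) hj
  have h2 := mfderiv_comp (f := sphereIncl g) (g := fiberScale (Real.exp z.2)) z.1
    (contMDiff_mdifferentiableAt (contMDiff_fiberScale_const (I := I) (Real.exp z.2)) _)
    (contMDiff_mdifferentiableAt hι.contMDiff z.1)
  exact congrArg α (DFunLike.congr_fun (h1.symm.trans h2) w)

theorem covectorPullback_polarMap_right
    (hι : IsSmoothEmb (dualModel I F) (sphereModel I F) (sphereIncl g))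
    (z : unitSphereBundle g × ℝ) (α : Cotangent (dualModel I F) (polarMap g z)) :
    covectorPullback ((sphereModel I F).prod 𝓘(ℝ, ℝ)) 𝓘(ℝ, ℝ) (fun t : ℝ ↦ (z.1, t)) z.2
      (covectorPullback (dualModel I F) ((sphereModel I F).prod 𝓘(ℝ, ℝ)) (polarMap g) z α) (1 : ℝ) =
    covectorPullback (dualModel I F) (dualModel I F) (fiberScale (Real.exp z.2))
        (z.1 : DualTotal F A) α (liouville I F A (z.1 : DualTotal F A)) := by
  have hk : MDifferentiableAt 𝓘(ℝ, ℝ) ((sphereModel I F).prod 𝓘(ℝ, ℝ))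
      (fun t : ℝ ↦ (z.1, t)) z.2 :=
    mdifferentiableAt_const.prodMk mdifferentiableAt_id
  have h1 := mfderiv_comp (f := fun t : ℝ ↦ (z.1, t)) (g := polarMap g) z.2
    (contMDiff_mdifferentiableAt (contMDiff_polarMap hι) _) hk
  have h2 := mfderiv_fiberScale_exp (I := I) (z.1 : DualTotal F A) z.2
  exact congrArg α ((DFunLike.congr_fun h1.symm (1 : ℝ)).trans h2)

/-- The Poissonization of the Jacobi structure of the sphere bundle is the given linear Poisson
structure: on the covectors `(e^t)^* α`, the terms of `Λ - E ∧ ∂/∂t` that contain `X_κ` cancel. -/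
theorem IsLinearPoissonStructure.bivectorRelated_polarDiffeomorph
    (hP : IsLinearPoissonStructure I P)
    (hι : IsSmoothEmb (dualModel I F) (sphereModel I F) (sphereIncl g))
    {ΛS : CoBilinField (sphereModel I F) (unitSphereBundle g)}
    {RS : ∀ s : unitSphereBundle g, TangentSpace (sphereModel I F) s}
    (hΛ : BivectorRelated (dualModel I F) (sphereModel I F) (sphereIncl g) ΛS (dualLambda P g))
    (hR : VectorRelated (dualModel I F) (sphereModel I F) (sphereIncl g) RS (dualReeb P g)) :
    BivectorRelated (dualModel I F) ((sphereModel I F).prod 𝓘(ℝ, ℝ)) (polarDiffeomorph hι)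
      (poissonization (sphereModel I F) ΛS RS)
      (restrictOpens (dualModel I F) P (zeroSectionCompl F A)) := by
  suffices h : ∀ (z : unitSphereBundle g × ℝ) (α β : Cotangent (dualModel I F) (polarMap g z)),
      poissonization (sphereModel I F) ΛS RS z
        (covectorPullback (dualModel I F) ((sphereModel I F).prod 𝓘(ℝ, ℝ)) (polarMap g) z α)
        (covectorPullback (dualModel I F) ((sphereModel I F).prod 𝓘(ℝ, ℝ)) (polarMap g) z β) =
      P (fiberScale (Real.exp z.2) (z.1 : DualTotal F A)) α β from fun z α β ↦
    (congrArg₂ (fun x y ↦ poissonization (sphereModel I F) ΛS RS z x y)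
      (covectorPullback_polarEquiv hι z α) (covectorPullback_polarEquiv hι z β)).trans
      (h z (covectorOfOpens α) (covectorOfOpens β))
  intro z α β
  have h := hP.apply_fiberScale (Real.exp_ne_zero z.2) (sphere_snd_ne_zero g z.1) α β
  have hjα := covectorPullback_polarMap_left hι z α
  have hjβ := covectorPullback_polarMap_left hι z β
  have hkα := covectorPullback_polarMap_right hι z α
  have hkβ := covectorPullback_polarMap_right hι z β
  set a := covectorPullback (dualModel I F) (dualModel I F) (fiberScale (Real.exp z.2))
        (z.1 : DualTotal F A) α with ha
  set b := covectorPullback (dualModel I F) (dualModel I F) (fiberScale (Real.exp z.2))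
        (z.1 : DualTotal F A) β with hb
  set a' := covectorPullback (dualModel I F) ((sphereModel I F).prod 𝓘(ℝ, ℝ)) (polarMap g) z α
  set b' := covectorPullback (dualModel I F) ((sphereModel I F).prod 𝓘(ℝ, ℝ)) (polarMap g) z β
  have e : poissonization (sphereModel I F) ΛS RS z a' b' = Real.exp (-z.2) *
      (ΛS z.1 (covectorPullback _ (sphereModel I F) (fun y : unitSphereBundle g ↦ (y, z.2)) z.1 a')
        (covectorPullback _ (sphereModel I F) (fun y : unitSphereBundle g ↦ (y, z.2)) z.1 b') -
      (covectorPullback _ (sphereModel I F) (fun y : unitSphereBundle g ↦ (y, z.2)) z.1 a' (RS z.1) *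
        covectorPullback _ 𝓘(ℝ, ℝ) (fun t : ℝ ↦ (z.1, t)) z.2 b' (1 : ℝ) -
      covectorPullback _ 𝓘(ℝ, ℝ) (fun t : ℝ ↦ (z.1, t)) z.2 a' (1 : ℝ) *
      covectorPullback _ (sphereModel I F) (fun y : unitSphereBundle g ↦ (y, z.2)) z.1 b' (RS z.1))) := rfl
  have hRS : ∀ c : Cotangent (dualModel I F) (z.1 : DualTotal F A),
      covectorPullback (dualModel I F) (sphereModel I F) (sphereIncl g) z.1 c (RS z.1) =
        -c (kineticVF P g (z.1 : DualTotal F A)) :=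
    fun c ↦ (congrArg c (hR z.1)).trans (map_neg c _)
  rw [e, hjα, hjβ, hkα, hkβ, hΛ, hRS, hRS, dualLambda_apply]
  -- the terms with `Δ` and `X_κ` cancel, and `P` is homogeneous
  have hexp : Real.exp (-z.2) * Real.exp z.2 = 1 := by rw [← Real.exp_add]; simp
  calc _ = Real.exp (-z.2) * P (z.1 : DualTotal F A) a b := by ring
    _ = _ := by rw [h, ← mul_assoc, hexp, one_mul]

end Poissonization

/-! ### Submanifold charts -/

section SubmanifoldCharts

variable {E : Type*} [NormedAddCommGroup E] [NormedSpace ℝ E]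
  {H : Type*} [TopologicalSpace H] (I : ModelWithCorners ℝ E H)
  {M : Type*} [TopologicalSpace M] [ChartedSpace H M]
  {E' : Type*} [NormedAddCommGroup E'] [NormedSpace ℝ E']
  {H' : Type*} [TopologicalSpace H'] (J : ModelWithCorners ℝ E' H') [J.Boundaryless]

variable (E') in
/-- A local parametrization of a subset `S` of a manifold by an open subset of the vector space `E'`,
whose inverse is the restriction of a smooth map defined on an open subset of the manifold. -/
structure SubmanifoldChart (S : Set M) where
  source : Set M
  target : Set E'
  coord : M → E'
  param : E' → M
  open_source : IsOpen source
  open_target : IsOpen target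
  contMDiffOn_coord : ContMDiffOn I 𝓘(ℝ, E') ∞ coord source
  contMDiffOn_param : ContMDiffOn 𝓘(ℝ, E') I ∞ param target
  mapsTo_coord : ∀ x ∈ S, x ∈ source → coord x ∈ target
  mapsTo_param : ∀ v ∈ target, param v ∈ S ∧ param v ∈ source
  left_inv : ∀ x ∈ S, x ∈ source → param (coord x) = x
  right_inv : ∀ v ∈ target, coord (param v) = v

variable {I}

open scoped Classical in
/-- The chart of the subset `S`, with values in the model space of `J`. The base point `s₀` is the
value of the inverse outside the target. -/
def SubmanifoldChart.toOpenPartialHomeomorph {S : Set M} (c : SubmanifoldChart I E' S) (s₀ : S) :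
    OpenPartialHomeomorph S H' where
  toFun s := J.symm (c.coord s)
  invFun x := if h : J x ∈ c.target then ⟨c.param (J x), (c.mapsTo_param _ h).1⟩ else s₀
  source := Subtype.val ⁻¹' c.source
  target := J ⁻¹' c.target
  map_source' s hs := by
    change J (J.symm (c.coord s)) ∈ c.target
    rw [J.right_inv (by simp [J.range_eq_univ])]
    exact c.mapsTo_coord s s.2 hs
  map_target' x hx := by
    have hx' : J x ∈ c.target := hx
    rw [dif_pos hx']
    exact (c.mapsTo_param _ hx).2
  left_inv' s hs := by
    have h1 : J (J.symm (c.coord s)) = c.coord s := J.right_inv (by simp [J.range_eq_univ])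
    rw [dif_pos (by rw [h1]; exact c.mapsTo_coord s s.2 hs)]
    refine Subtype.ext ?_
    change c.param (J (J.symm (c.coord s))) = s
    rw [h1, c.left_inv s s.2 hs]
  right_inv' x hx := by
    have hx' : J x ∈ c.target := hx
    rw [dif_pos hx']
    change J.symm (c.coord (c.param (J x))) = x
    rw [c.right_inv _ hx, J.left_inv]
  open_source := c.open_source.preimage continuous_subtype_val
  open_target := c.open_target.preimage J.continuous
  continuousOn_toFun := J.continuous_symm.comp_continuousOn
    (c.contMDiffOn_coord.continuousOn.comp continuous_subtype_val.continuousOn fun _ h ↦ h)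
  continuousOn_invFun := by
    rw [Topology.IsInducing.subtypeVal.continuousOn_iff]
    refine (c.contMDiffOn_param.continuousOn.comp J.continuous.continuousOn
      fun _ h ↦ h).congr fun x hx ↦ ?_
    have hx' : J x ∈ c.target := hx
    simp [hx']

theorem SubmanifoldChart.coe_symm {S : Set M} (c : SubmanifoldChart I E' S) (s₀ : S) {x : H'}
    (hx : J x ∈ c.target) : ((c.toOpenPartialHomeomorph J s₀).symm x : M) = c.param (J x) :=
  congrArg Subtype.val (dif_pos hx)

theorem SubmanifoldChart.model_apply {S : Set M} (c : SubmanifoldChart I E' S) (s₀ s : S) :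
    J (c.toOpenPartialHomeomorph J s₀ s) = c.coord s :=
  J.right_inv (by simp [J.range_eq_univ])

/-- A subset of a manifold that is covered by submanifold charts is an embedded submanifold. -/
theorem exists_isManifold_isSmoothEmb {S : Set M} (c : S → SubmanifoldChart I E' S)
    (hc : ∀ s : S, (s : M) ∈ (c s).source) :
    ∃ (_ : ChartedSpace H' S) (_ : IsManifold J ∞ S),
      IsSmoothEmb I J (Subtype.val : S → M) := by
  let φ : S → OpenPartialHomeomorph S H' := fun s ↦ (c s).toOpenPartialHomeomorph J s
  let cs : ChartedSpace H' S :=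
    { atlas := Set.range φ
      chartAt := φ
      mem_chart_source := hc
      chart_mem_atlas := fun s ↦ ⟨s, rfl⟩ }
  have hm : IsManifold J ∞ S := by
    refine isManifold_of_contDiffOn J ∞ S ?_
    rintro _ _ ⟨s, rfl⟩ ⟨t, rfl⟩
    rw [← contMDiffOn_iff_contDiffOn]
    have hJ : ∀ v : E', J (J.symm v) = v := fun v ↦ J.right_inv (by simp [J.range_eq_univ])
    have key : ∀ v ∈ J.symm ⁻¹' ((φ s).symm ≫ₕ φ t).source ∩ Set.range J,
        v ∈ (c s).target ∧ (c s).param v ∈ (c t).source ∧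
          (((φ s).symm (J.symm v) : S) : M) = (c s).param v := by
      rintro v ⟨⟨h1, h2⟩, -⟩
      have h1' : J (J.symm v) ∈ (c s).target := h1
      have h3 := (c s).coe_symm J s h1'
      have h2' : (((φ s).symm (J.symm v) : S) : M) ∈ (c t).source := h2
      rw [hJ] at h1' h3
      exact ⟨h1', h3 ▸ h2', h3⟩
    refine (((c t).contMDiffOn_coord.comp' (c s).contMDiffOn_param).mono
      fun v hv ↦ ⟨(key v hv).1, (key v hv).2.1⟩).congr fun v hv ↦ ?_
    change J (φ t ((φ s).symm (J.symm v))) = (c t).coord ((c s).param v)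
    rw [(c t).model_apply J t, (key v hv).2.2]
  have hx : ∀ s s' : S, extChartAt J s s' = (c s).coord s' := fun s s' ↦ (c s).model_apply J s s'
  have hι : ContMDiff J I ∞ (Subtype.val : S → M) := by
    intro s
    have h1 : ContMDiffAt J 𝓘(ℝ, E') ∞ (extChartAt J s) s := contMDiffAt_extChartAt
    have h2 : ContMDiffAt 𝓘(ℝ, E') I ∞ (c s).param (extChartAt J s s) := by
      refine (c s).contMDiffOn_param.contMDiffAt ((c s).open_target.mem_nhds ?_)
      rw [hx]
      exact (c s).mapsTo_coord s s.2 (hc s)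
    refine (h2.comp s h1).congr_of_eventuallyEq ?_
    filter_upwards [((c s).open_source.preimage continuous_subtype_val).mem_nhds (hc s)] with s' hs'
    rw [Function.comp_apply, hx, (c s).left_inv s' s'.2 hs']
  refine ⟨cs, hm, hι, Topology.IsEmbedding.subtypeVal, fun s ↦ ?_⟩
  -- the differential of the chart factors through that of the inclusion
  have h1 : MDifferentiableAt I 𝓘(ℝ, E') (c s).coord (s : M) :=
    ((c s).contMDiffOn_coord.contMDiffAt ((c s).open_source.mem_nhds (hc s))).mdifferentiableAt
      (by simp)
  have h2 := mfderiv_comp s h1 (contMDiff_mdifferentiableAt hι s)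
  have h3 : (c s).coord ∘ (Subtype.val : S → M) = extChartAt J s := funext fun s' ↦ (hx s s').symm
  rw [h3, mfderiv_extChartAt_self] at h2
  refine Function.Injective.of_comp (f := mfderiv I 𝓘(ℝ, E') (c s).coord (s : M)) ?_
  refine fun v w hvw ↦ ?_
  exact (DFunLike.congr_fun h2 v).trans (hvw.trans (DFunLike.congr_fun h2 w).symm)

end SubmanifoldCharts

/-! ### Charts of the sphere bundle -/

section SphereBundleCharts

variable {EQ : Type*} [NormedAddCommGroup EQ] [NormedSpace ℝ EQ] [FiniteDimensional ℝ EQ]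
  {HQ : Type*} [TopologicalSpace HQ] {I : ModelWithCorners ℝ EQ HQ} [I.Boundaryless]
  {Q : Type*} [TopologicalSpace Q] [T2Space Q] [ChartedSpace HQ Q] [IsManifold I ∞ Q]
  {F : Type*} [NormedAddCommGroup F] [NormedSpace ℝ F] [FiniteDimensional ℝ F]
  {A : Q → Type*} [TopologicalSpace (TotalSpace F A)]
  [∀ q, AddCommGroup (A q)] [∀ q, Module ℝ (A q)] [∀ q, TopologicalSpace (A q)]
  [∀ q, IsTopologicalAddGroup (A q)] [∀ q, ContinuousSMul ℝ (A q)]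
  [FiberBundle F A] [VectorBundle ℝ F A] [ContMDiffVectorBundle ∞ F A I]
  (g : ContMDiffRiemannianMetric I ∞ F A)

/-- The dual space splits as a line and a complement, with a prescribed covector on the positive side
of the complement. -/
theorem exists_equiv_prod_fst_pos {y : F →L[ℝ] ℝ} (hy : y ≠ 0) :
    ∃ T : (F →L[ℝ] ℝ) ≃L[ℝ] ℝ × EuclideanSpace ℝ (Fin (finrank ℝ F - 1)), 0 < (T y).1 := by
  have hpos : 0 < finrank ℝ F := by
    by_contra h
    have : Subsingleton F := (finrank_zero_iff (R := ℝ) (M := F)).1 (by omega)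
    exact hy (Subsingleton.elim _ _)
  have hdim : finrank ℝ (F →L[ℝ] ℝ) =
      finrank ℝ (ℝ × EuclideanSpace ℝ (Fin (finrank ℝ F - 1))) := by
    rw [← (LinearMap.toContinuousLinearMap : (F →ₗ[ℝ] ℝ) ≃ₗ[ℝ] F →L[ℝ] ℝ).finrank_eq,
      Subspace.dual_finrank_eq, finrank_prod, finrank_self, finrank_euclideanSpace_fin]
    omega
  let T₀ := ContinuousLinearEquiv.ofFinrankEq hdim
  obtain ⟨B, hB⟩ := SeparatingDual.exists_continuousLinearEquiv_apply_eq (R := ℝ)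
    (x := T₀ y) (y := ((1 : ℝ), (0 : EuclideanSpace ℝ (Fin (finrank ℝ F - 1)))))
    (by simpa using hy) (by simp)
  refine ⟨T₀.trans B, ?_⟩
  change 0 < (B (T₀ y)).1
  rw [hB]
  exact one_pos

variable (A) in
/-- The point of `A*` with base point `q` and fiber coordinate `y` in the trivialization at `q₀`. -/
def dualOfCoord (q₀ q : Q) (y : F →L[ℝ] ℝ) : DualTotal F A :=
  (trivializationAt (F →L[ℝ] ℝ) (fun q ↦ A q →L[ℝ] ℝ) q₀).toOpenPartialHomeomorph.symm (q, y)

theorem dualOfCoord_fst {q₀ q : Q} (hq : q ∈ (trivializationAt F A q₀).baseSet) (y : F →L[ℝ] ℝ) :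
    (dualOfCoord A q₀ q y).1 = q :=
  Trivialization.proj_symm_apply' _ (by rw [dual_baseSet]; exact hq)

theorem dualCoord_dualOfCoord {q₀ q : Q} (hq : q ∈ (trivializationAt F A q₀).baseSet)
    (y : F →L[ℝ] ℝ) : dualCoord q₀ (dualOfCoord A q₀ q y) = y :=
  congrArg Prod.snd (Trivialization.apply_symm_apply'
    (trivializationAt (F →L[ℝ] ℝ) (fun q ↦ A q →L[ℝ] ℝ) q₀) (by rw [dual_baseSet]; exact hq))

theorem dualOfCoord_dualCoord {q₀ : Q} {p : DualTotal F A}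
    (hp : p.1 ∈ (trivializationAt F A q₀).baseSet) (c : ℝ) :
    dualOfCoord A q₀ p.1 (c • dualCoord q₀ p) = fiberScale c p := by
  set e := trivializationAt (F →L[ℝ] ℝ) (fun q ↦ A q →L[ℝ] ℝ) q₀
  have hs : fiberScale c p ∈ e.source := by
    rw [Trivialization.mem_source, dual_baseSet]; exact hp
  have h : e (fiberScale c p) = (p.1, c • dualCoord q₀ p) :=
    Prod.ext (Trivialization.coe_fst _ hs) (dualCoord_smul q₀ p.1 c p.2)
  unfold dualOfCoord
  rw [← h]
  exact e.toOpenPartialHomeomorph.left_inv hs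

theorem contMDiffAt_dualOfCoord {q₀ q : Q} (hq : q ∈ (trivializationAt F A q₀).baseSet)
    (y : F →L[ℝ] ℝ) :
    ContMDiffAt (I.prod 𝓘(ℝ, F →L[ℝ] ℝ)) (dualModel I F) ∞
      (fun z : Q × (F →L[ℝ] ℝ) ↦ dualOfCoord A q₀ z.1 z.2) (q, y) := by
  set e := trivializationAt (F →L[ℝ] ℝ) (fun q ↦ A q →L[ℝ] ℝ) q₀
  have h : (q, y) ∈ e.target := by rw [Trivialization.mem_target, dual_baseSet]; exact hq
  exact (Trivialization.contMDiffOn_symm (IB := I) (n := ∞) e).contMDiffAt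
    (e.open_target.mem_nhds h)

theorem dualOfCoord_ne_zero {q₀ q : Q} (hq : q ∈ (trivializationAt F A q₀).baseSet)
    {y : F →L[ℝ] ℝ} (hy : y ≠ 0) : (dualOfCoord A q₀ q y).2 ≠ 0 := fun h ↦ hy <| by
  rwa [← dualCoord_eq_zero_iff (q₀ := q₀) (by rw [dualOfCoord_fst hq]; exact hq),
    dualCoord_dualOfCoord hq] at h

theorem exists_dualCoord_sphereProj {q₀ q : Q} (hq : q ∈ (trivializationAt F A q₀).baseSet)
    {y : F →L[ℝ] ℝ} (hy : y ≠ 0) :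
    ∃ c : ℝ, 0 < c ∧ dualCoord q₀ (sphereProj g (dualOfCoord A q₀ q y)) = c • y := by
  have h := kineticEnergy_pos g (dualOfCoord_ne_zero hq hy)
  refine ⟨(√(2 * kineticEnergy g (dualOfCoord A q₀ q y)))⁻¹,
    inv_pos.2 (Real.sqrt_pos.2 (by positivity)), ?_⟩
  refine (dualCoord_smul q₀ _ _ _).trans ?_
  exact congrArg _ (dualCoord_dualOfCoord hq y)

/-- The chart of the sphere bundle over a chart of `Q` and a trivialization of `A`, given by the
central projection of the open half sphere where the first component of `T` is positive to a
hyperplane. -/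
def sphereChart (q₀ : Q)
    (T : (F →L[ℝ] ℝ) ≃L[ℝ] ℝ × EuclideanSpace ℝ (Fin (finrank ℝ F - 1))) :
    SubmanifoldChart (dualModel I F) (EQ × EuclideanSpace ℝ (Fin (finrank ℝ F - 1)))
      (unitSphereBundle g) where
  source := {p | (p.1 ∈ (chartAt HQ q₀).source ∧ p.1 ∈ (trivializationAt F A q₀).baseSet) ∧
    0 < (T (dualCoord q₀ p)).1}
  target := ((extChartAt I q₀).target ∩
    (extChartAt I q₀).symm ⁻¹' (trivializationAt F A q₀).baseSet) ×ˢ Set.univ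
  coord p := (extChartAt I q₀ p.1, (T (dualCoord q₀ p)).1⁻¹ • (T (dualCoord q₀ p)).2)
  param v := sphereProj g (dualOfCoord A q₀ ((extChartAt I q₀).symm v.1) (T.symm (1, v.2)))
  open_source := by
    rw [isOpen_iff_mem_nhds]
    rintro p ⟨⟨h1, h2⟩, h3⟩
    have hc := (contMDiff_dualProj (I := I) (F := F) (A := A)).continuous.continuousAt (x := p)
    have hd : ContinuousAt (fun p ↦ (T (dualCoord q₀ p)).1) p :=
      (continuous_fst.comp T.continuous).continuousAt.comp
        (contMDiffAt_dualCoord (I := I) h2).continuousAt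
    filter_upwards [hc.eventually ((chartAt HQ q₀).open_source.mem_nhds h1),
      hc.eventually ((trivializationAt F A q₀).open_baseSet.mem_nhds h2),
      hd.eventually (lt_mem_nhds h3)] with p' h1' h2' h3'
    exact ⟨⟨h1', h2'⟩, h3'⟩
  open_target := ((continuousOn_extChartAt_symm q₀).isOpen_inter_preimage
    (isOpen_extChartAt_target q₀) (trivializationAt F A q₀).open_baseSet).prod isOpen_univ
  contMDiffOn_coord := by
    rintro p ⟨⟨h1, h2⟩, h3⟩
    refine ContMDiffAt.contMDiffWithinAt ?_
    have hx : ContMDiffAt (dualModel I F) 𝓘(ℝ, EQ) ∞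
        (fun p : DualTotal F A ↦ extChartAt I q₀ p.1) p :=
      ContMDiffAt.comp (f := TotalSpace.proj) p (contMDiffAt_extChartAt' h1) (contMDiff_dualProj p)
    have hy : ContMDiffAt (dualModel I F) 𝓘(ℝ, ℝ × EuclideanSpace ℝ (Fin (finrank ℝ F - 1))) ∞
        (fun p : DualTotal F A ↦ T (dualCoord q₀ p)) p :=
      T.contDiff.contMDiff.contMDiffAt.comp p (contMDiffAt_dualCoord h2)
    have hw : ContDiffAt ℝ ∞
        (fun z : ℝ × EuclideanSpace ℝ (Fin (finrank ℝ F - 1)) ↦ z.1⁻¹ • z.2) (T (dualCoord q₀ p)) :=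
      (contDiffAt_fst.inv h3.ne').smul contDiffAt_snd
    have hz : ContMDiffAt (dualModel I F) 𝓘(ℝ, EuclideanSpace ℝ (Fin (finrank ℝ F - 1))) ∞
        (fun p : DualTotal F A ↦ (T (dualCoord q₀ p)).1⁻¹ • (T (dualCoord q₀ p)).2) p :=
      ContMDiffAt.comp (f := fun p ↦ T (dualCoord q₀ p)) p hw.contMDiffAt hy
    exact hx.prodMk_space hz
  contMDiffOn_param := by
    rintro ⟨x, w⟩ ⟨⟨h1, h2⟩, -⟩
    refine ContMDiffAt.contMDiffWithinAt ?_
    have hx : ContMDiffAt 𝓘(ℝ, EQ × EuclideanSpace ℝ (Fin (finrank ℝ F - 1))) I ∞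
        (fun v ↦ (extChartAt I q₀).symm v.1) (x, w) := by
      have h0 : ContMDiffAt 𝓘(ℝ, EQ) I ∞ (extChartAt I q₀).symm x :=
        (contMDiffOn_extChartAt_symm q₀).contMDiffAt
          ((isOpen_extChartAt_target q₀).mem_nhds h1)
      exact ContMDiffAt.comp (f := Prod.fst) (x, w) h0 contDiff_fst.contMDiff.contMDiffAt
    have hy : ContMDiffAt 𝓘(ℝ, EQ × EuclideanSpace ℝ (Fin (finrank ℝ F - 1)))
        𝓘(ℝ, F →L[ℝ] ℝ) ∞ (fun v ↦ T.symm (1, v.2)) (x, w) :=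
      (T.symm.contDiff.comp (contDiff_const.prodMk contDiff_snd)).contMDiff.contMDiffAt
    have hne := dualOfCoord_ne_zero (A := A) h2 (y := T.symm (1, w)) (by simp)
    exact ContMDiffAt.comp (x, w) (contMDiffAt_sphereProj g hne)
      (ContMDiffAt.comp (x, w) (contMDiffAt_dualOfCoord h2 _) (hx.prodMk hy))
  mapsTo_coord := by
    rintro p - ⟨⟨h1, h2⟩, -⟩
    rw [← extChartAt_source I] at h1
    refine ⟨⟨(extChartAt I q₀).map_source h1, ?_⟩, trivial⟩
    change (extChartAt I q₀).symm (extChartAt I q₀ p.1) ∈ (trivializationAt F A q₀).baseSet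
    rw [(extChartAt I q₀).left_inv h1]
    exact h2
  mapsTo_param := by
    rintro ⟨x, w⟩ ⟨⟨h1, h2⟩, -⟩
    have hne : T.symm (1, w) ≠ 0 := by simp
    obtain ⟨c, hc, h⟩ := exists_dualCoord_sphereProj g h2 hne
    have hb : (sphereProj g (dualOfCoord A q₀ ((extChartAt I q₀).symm x) (T.symm (1, w)))).1 =
      (extChartAt I q₀).symm x := dualOfCoord_fst h2 (T.symm (1, w))
    refine ⟨sphereProj_mem g (dualOfCoord_ne_zero h2 hne), ⟨?_, ?_⟩, ?_⟩
    · rw [hb, ← extChartAt_source I]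
      exact (extChartAt I q₀).map_target h1
    · rw [hb]
      exact h2
    · rw [h, map_smul, T.apply_symm_apply]
      simpa using hc
  left_inv := by
    rintro p hp ⟨⟨h1, h2⟩, h3⟩
    rw [← extChartAt_source I] at h1
    have h4 : T.symm (1, (T (dualCoord q₀ p)).1⁻¹ • (T (dualCoord q₀ p)).2) =
        (T (dualCoord q₀ p)).1⁻¹ • dualCoord q₀ p := by
      rw [T.symm_apply_eq, map_smul]
      exact Prod.ext (inv_mul_cancel₀ h3.ne').symm rfl
    simp only
    rw [(extChartAt I q₀).left_inv h1, h4, dualOfCoord_dualCoord h2,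
      sphereProj_fiberScale g (inv_pos.2 h3), sphereProj_of_mem g hp]
  right_inv := by
    rintro ⟨x, w⟩ ⟨⟨h1, h2⟩, -⟩
    obtain ⟨c, hc, h⟩ := exists_dualCoord_sphereProj g h2 (y := T.symm (1, w)) (by simp)
    have hb : (sphereProj g (dualOfCoord A q₀ ((extChartAt I q₀).symm x) (T.symm (1, w)))).1 =
      (extChartAt I q₀).symm x := dualOfCoord_fst h2 (T.symm (1, w))
    refine Prod.ext ?_ ?_
    · simp only
      rw [hb]
      exact (extChartAt I q₀).right_inv h1
    · simp only
      rw [h, map_smul, T.apply_symm_apply]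
      simp [smul_smul, hc.ne']

/-- The unit sphere bundle is an embedded submanifold of codimension one. -/
theorem exists_isSmoothEmb_sphereIncl :
    ∃ (_ : ChartedSpace (ModelProd HQ (EuclideanSpace ℝ (Fin (finrank ℝ F - 1))))
        (unitSphereBundle g)) (_ : IsManifold (sphereModel I F) ∞ (unitSphereBundle g)),
      IsSmoothEmb (dualModel I F) (sphereModel I F) (sphereIncl g) := by
  have h0 : ∀ s : unitSphereBundle g,
      dualCoord (s : DualTotal F A).1 (s : DualTotal F A) ≠ 0 := fun s h ↦
    sphere_snd_ne_zero g s
      ((dualCoord_eq_zero_iff (FiberBundle.mem_baseSet_trivializationAt' _)).1 h)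
  choose T hT using fun s ↦ exists_equiv_prod_fst_pos (h0 s)
  exact exists_isManifold_isSmoothEmb (sphereModel I F)
    (fun s ↦ sphereChart g (s : DualTotal F A).1 (T s))
    fun s ↦ ⟨⟨mem_chart_source HQ _, FiberBundle.mem_baseSet_trivializationAt' _⟩, hT s⟩

end SphereBundleCharts

end

/-! ### Jacobi structures of linear Poisson structures -/

theorem theorem3p1
    {EQ : Type*} [NormedAddCommGroup EQ] [NormedSpace ℝ EQ] [FiniteDimensional ℝ EQ]
    {HQ : Type*} [TopologicalSpace HQ] (I : ModelWithCorners ℝ EQ HQ) [I.Boundaryless]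
    {Q : Type*} [TopologicalSpace Q] [T2Space Q] [SecondCountableTopology Q]
    [ChartedSpace HQ Q] [IsManifold I ∞ Q]
    {F : Type*} [NormedAddCommGroup F] [NormedSpace ℝ F] [FiniteDimensional ℝ F]
    {A : Q → Type*} [TopologicalSpace (TotalSpace F A)]
    [∀ q, AddCommGroup (A q)] [∀ q, Module ℝ (A q)] [∀ q, TopologicalSpace (A q)]
    [∀ q, IsTopologicalAddGroup (A q)] [∀ q, ContinuousSMul ℝ (A q)]
    [FiberBundle F A] [VectorBundle ℝ F A] [ContMDiffVectorBundle ∞ F A I]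
    (P : CoBilinField (dualModel I F) (DualTotal F A)) (hP : IsLinearPoissonStructure I P)
    (g : ContMDiffRiemannianMetric I ∞ F A) :
    -- (i) the pair `(Λ, R) = (P + Δ ∧ X_κ, -X_κ)` is a Jacobi structure on `A*`
    IsJacobiStructure (dualModel I F) (dualLambda P g) (dualReeb P g) ∧
    -- the sphere bundle is an embedded submanifold of `A*` of codimension one
    (∃ (_ : ChartedSpace (ModelProd HQ (EuclideanSpace ℝ (Fin (finrank ℝ F - 1))))
        (unitSphereBundle g)) (_ : IsManifold (sphereModel I F) ∞ (unitSphereBundle g)),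
      IsSmoothEmb (dualModel I F) (sphereModel I F) (sphereIncl g)) ∧
    -- and, for its structure of submanifold:
    (∀ (_ : ChartedSpace (ModelProd HQ (EuclideanSpace ℝ (Fin (finrank ℝ F - 1))))
        (unitSphereBundle g)) (_ : IsManifold (sphereModel I F) ∞ (unitSphereBundle g)),
      IsSmoothEmb (dualModel I F) (sphereModel I F) (sphereIncl g) →
      ∃ (ΛS : CoBilinField (sphereModel I F) (unitSphereBundle g))
        (RS : ∀ s : unitSphereBundle g, TangentSpace (sphereModel I F) s),
        -- (ii) `(Λ, R)` restricts to a Jacobi structure `(ΛS, RS)` on the sphere bundle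
        IsJacobiStructure (sphereModel I F) ΛS RS ∧
        BivectorRelated (dualModel I F) (sphereModel I F) (sphereIncl g) ΛS (dualLambda P g) ∧
        VectorRelated (dualModel I F) (sphereModel I F) (sphereIncl g) RS (dualReeb P g) ∧
        -- and `(β, t) ↦ e^t β` is a Poisson isomorphism from its Poissonization
        (∃ Ψ : Diffeomorph ((sphereModel I F).prod 𝓘(ℝ, ℝ)) (dualModel I F)
            (unitSphereBundle g × ℝ) (zeroSectionCompl F A) ∞,
          (∀ (s : unitSphereBundle g) (t : ℝ), (Ψ (s, t) : DualTotal F A) =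
            ⟨(s : DualTotal F A).1, Real.exp t • (s : DualTotal F A).2⟩) ∧
          BivectorRelated (dualModel I F) ((sphereModel I F).prod 𝓘(ℝ, ℝ)) Ψ
            (poissonization (sphereModel I F) ΛS RS)
            (restrictOpens (dualModel I F) P (zeroSectionCompl F A))) ∧
        -- (iii) the formula for the Jacobi bracket on the sphere bundle
        (∀ G₁ G₂ : DualTotal F A → ℝ,
          ContMDiff (dualModel I F) 𝓘(ℝ, ℝ) ∞ G₁ → ContMDiff (dualModel I F) 𝓘(ℝ, ℝ) ∞ G₂ →
          ∀ s : unitSphereBundle g,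
            jacobiBracket (sphereModel I F) ΛS RS (G₁ ∘ sphereIncl g) (G₂ ∘ sphereIncl g) s =
              bivectorBracket (dualModel I F) P G₁ G₂ s
              - bivectorBracket (dualModel I F) P (kineticEnergy g) G₁ s
                * (G₂ s - lieDerivFun (dualModel I F) (liouville I F A) G₂ s)
              + bivectorBracket (dualModel I F) P (kineticEnergy g) G₂ s
                * (G₁ s - lieDerivFun (dualModel I F) (liouville I F A) G₁ s))) := by
  refine ⟨hP.isJacobiStructure g, exists_isSmoothEmb_sphereIncl g, fun _ _ hι ↦ ?_⟩
  have halt := hP.isPoissonStructure.isBivectorField.alt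
  obtain ⟨ΛS, hΛalt, hΛ⟩ := exists_bivectorRelated halt hι
  obtain ⟨RS, hR⟩ := exists_vectorRelated halt hι
  exact ⟨ΛS, RS, hP.isJacobiStructure_sphere hι hΛalt hΛ hR, hΛ, hR,
    ⟨polarDiffeomorph hι, fun _ _ ↦ rfl, hP.bivectorRelated_polarDiffeomorph hι hΛ hR⟩,
    fun _ _ h₁ h₂ s ↦ jacobiBracket_sphere hι hΛ hR h₁ h₂ s⟩
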